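/- Let $\Gamma$ be a (discrete) torsion-free group, and let $K\subset\mathbb{C}$ be a subfield closed under complex conjugation. Let $l^2\Gamma$ be the Hilbert space of square-summable complex functions on $\Gamma$, on which the group ring $K\Gamma$ acts by left convolution, and let $\mathcal{N}\Gamma$ be the group von Neumann algebra, i.e. the algebra of all bounded operators on $l^2\Gamma$ that commute with the right translations by elements of $\Gamma$. For a closed, right $\Gamma$-invariant subspace $V\subset (l^2\Gamma)^d$ with orthogonal projection $\mathrm{pr}_V$, put $\dim_\Gamma(V)=\sum_{i=1}^d\langle \mathrm{pr}_V(e_i),e_i\rangle$, where $e_i\in(l^2\Gamma)^d$ has the characteristic function of $1\in\Gamma$ as its $i$-th entry and all other entries zero. Let $Fin^{-1}(\Gamma)$ be the additive subgroup of $\mathbb{Q}$ generated by the numbers $1/|F|$, $F$ a finite subgroup of $\Gamma$. $K\Gamma$ is said to satisfy the algebraic Atiyah conjecture if the following holds: if $Fin^{-1}(\Gamma)$ is a discrete subset of $\mathbb{R}$, then for every $d$ and every matrix $A\in M(d\times d,K\Gamma)$, acting on $(l^2\Gamma)^d$ by left multiplication, $\dim_\Gamma(\ker A)\in Fin^{-1}(\Gamma)$.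 (As $\Gamma$ is torsion-free, $Fin^{-1}(\Gamma)=\mathbb{Z}$.) Let $\mathcal{U}\Gamma$ be the algebra of all closed, densely defined operators on $l^2\Gamma$ that are affiliated to $\mathcal{N}\Gamma$ (that is, $bT\subseteq Tb$ for every bounded operator $b$ in the commutant of $\mathcal{N}\Gamma$), where the sum and the product are the closures of the operator sum and of the composition on their natural domains. Let $D_K\Gamma$ be the division closure of $K\Gamma$ in $\mathcal{U}\Gamma$, i.e. the smallest subring of $\mathcal{U}\Gamma$ that contains $K\Gamma$ and contains $x^{-1}$ for each of its elements $x$ that is invertible in $\mathcal{U}\Gamma$. Then $K\Gamma$ satisfies the algebraic Atiyah conjecture if and only if $D_K\Gamma$ is a skew field. -/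

import Mathlib

open scoped ENNReal InnerProductSpace

noncomputable section

namespace L2Group

/-- The Hilbert space `l²(Γ)` of square-summable complex functions on the discrete group `Γ`. -/
abbrev L2 (Γ : Type*) : Type _ := lp (fun _ : Γ => ℂ) 2

/-- Precomposition with a permutation preserves square-summability. -/
theorem memlp_comp_perm {Γ : Type*} (σ : Equiv.Perm Γ) (f : L2 Γ) :
    Memℓp (fun h => f (σ h)) (2 : ℝ≥0∞) := by
  have hp : 0 < (2 : ℝ≥0∞).toReal := by norm_num
  exact memℓp_gen (((lp.memℓp f).summable hp).comp_injective σ.injective)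

/-- The unitary operator `f ↦ f ∘ σ` of `l²(Γ)` given by a permutation `σ` of `Γ`. -/
def permUnitary {Γ : Type*} (σ : Equiv.Perm Γ) : L2 Γ ≃ₗᵢ[ℂ] L2 Γ where
  toFun f := ⟨fun h => f (σ h), memlp_comp_perm σ f⟩
  invFun f := ⟨fun h => f (σ.symm h), memlp_comp_perm σ.symm f⟩
  map_add' _ _ := rfl
  map_smul' _ _ := rfl
  left_inv f := by ext h; simp
  right_inv f := by ext h; simp
  norm_map' f := by
    have hp : 0 < (2 : ℝ≥0∞).toReal := by norm_num
    rw [lp.norm_eq_tsum_rpow hp, lp.norm_eq_tsum_rpow hp]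
    congr 1
    exact σ.tsum_eq (fun h => ‖f h‖ ^ (2 : ℝ≥0∞).toReal)

section Group

variable {Γ : Type*} [Group Γ]

/-- Left translation by `g`, sending `∑ λ_h h` to `∑ λ_h (g h)`. -/
def leftTranslation (g : Γ) : L2 Γ →L[ℂ] L2 Γ :=
  ((permUnitary (Equiv.mulLeft g⁻¹) : L2 Γ ≃L[ℂ] L2 Γ) : L2 Γ →L[ℂ] L2 Γ)

/-- Right translation by `g`, sending `∑ λ_h h` to `∑ λ_h (h g)`. -/
def rightTranslation (g : Γ) : L2 Γ →L[ℂ] L2 Γ :=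
  ((permUnitary (Equiv.mulRight g⁻¹) : L2 Γ ≃L[ℂ] L2 Γ) : L2 Γ →L[ℂ] L2 Γ)

variable (Γ) in
/-- The group von Neumann algebra `𝒩Γ`: the bounded operators on `l²(Γ)` that commute with all
right translations (see `mem_groupVN_iff`). -/
def groupVN : VonNeumannAlgebra (L2 Γ) where
  toStarSubalgebra :=
    StarSubalgebra.centralizer ℂ (Set.range (rightTranslation : Γ → L2 Γ →L[ℂ] L2 Γ))
  centralizer_centralizer' := by simp

/-- The adjoint of a right translation is the right translation by the inverse. -/
theorem star_rightTranslation (g : Γ) :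
    star (rightTranslation g) = rightTranslation g⁻¹ := by
  have h : (permUnitary (Equiv.mulRight g⁻¹)).symm = permUnitary (Equiv.mulRight g⁻¹⁻¹) := by
    ext f h
    simp only [permUnitary, Equiv.coe_mulRight, Equiv.mulRight_symm_apply, inv_inv]
    rfl
  rw [ContinuousLinearMap.star_eq_adjoint]
  unfold rightTranslation
  rw [← h]
  exact (permUnitary (Equiv.mulRight g⁻¹)).adjoint_eq_symm

theorem mem_groupVN_iff (T : L2 Γ →L[ℂ] L2 Γ) :
    T ∈ groupVN Γ ↔ ∀ g : Γ, rightTranslation g * T = T * rightTranslation g := by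
  change T ∈ StarSubalgebra.centralizer ℂ _ ↔ _
  rw [StarSubalgebra.mem_centralizer_iff]
  constructor
  · intro h g
    exact (h _ ⟨g, rfl⟩).1
  · rintro h _ ⟨g, rfl⟩
    exact ⟨h g, by rw [star_rightTranslation]; exact h g⁻¹⟩

/-! ### The group ring and matrices over it as bounded operators -/

/-- The action of `a = ∑ c_g g` in `KΓ` on `l²(Γ)` by left convolution. -/
def groupRingOp {K : Subfield ℂ} (a : MonoidAlgebra K Γ) : L2 Γ →L[ℂ] L2 Γ :=
  a.coeff.sum fun g c => (c : ℂ) • leftTranslation g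

/-- The Hilbert space `l²(Γ)^d`. -/
abbrev L2Pow (Γ : Type*) (d : ℕ) : Type _ := PiLp 2 fun _ : Fin d => L2 Γ

/-- The action of a `d × d` matrix over `KΓ` on `l²(Γ)^d`: `(A v)_i = ∑ j, A_ij v_j`. -/
def matrixOp {K : Subfield ℂ} {d : ℕ} (A : Matrix (Fin d) (Fin d) (MonoidAlgebra K Γ)) :
    L2Pow Γ d →L[ℂ] L2Pow Γ d :=
  (PiLp.continuousLinearEquiv 2 ℂ fun _ : Fin d => L2 Γ).symm.toContinuousLinearMap ∘L
    ContinuousLinearMap.pi fun i =>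
      ∑ j, groupRingOp (A i j) ∘L PiLp.proj 2 (fun _ : Fin d => L2 Γ) j

open Classical in
/-- The vector `e_i` of `l²(Γ)^d`: its `i`-th entry is the characteristic function of `1 ∈ Γ` and
all its other entries are zero. -/
def stdVec (Γ : Type*) [Group Γ] {d : ℕ} (i : Fin d) : L2Pow Γ d :=
  WithLp.toLp 2 (Pi.single i (lp.single 2 (1 : Γ) (1 : ℂ)))

/-- The `Γ`-dimension `∑ i, ⟨pr e_i, e_i⟩` of a (closed, `Γ`-invariant) subspace of `l²(Γ)^d`, where
`pr` is the orthogonal projection onto the subspace. Each summand is real. -/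
def gammaDim {d : ℕ} (V : Submodule ℂ (L2Pow Γ d)) [V.HasOrthogonalProjection] : ℝ :=
  ∑ i, (⟪V.starProjection (stdVec Γ i), stdVec Γ i⟫_ℂ).re

/-! ### The algebraic Atiyah conjecture -/

variable (Γ) in
/-- `Fin⁻¹(Γ)`: the additive group generated by `1 / |F|` for the finite subgroups `F` of `Γ`. -/
def finInv : AddSubgroup ℝ :=
  AddSubgroup.closure {r | ∃ F : Subgroup Γ, Finite F ∧ r = 1 / (Nat.card F : ℝ)}

variable (Γ) in
/-- The statement of the algebraic Atiyah conjecture for `KΓ`. -/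
def AlgebraicAtiyah (K : Subfield ℂ) : Prop :=
  DiscreteTopology (finInv Γ) →
    ∀ (d : ℕ) (A : Matrix (Fin d) (Fin d) (MonoidAlgebra K Γ)),
      gammaDim (LinearMap.ker (matrixOp A).toLinearMap) ∈ finInv Γ

/-! ### Affiliated operators -/

variable (Γ) in
/-- `T` belongs to `𝒰Γ`: it is a closed, densely defined operator on `l²(Γ)` that is affiliated to
`𝒩Γ`, i.e. `b T ⊆ T b` for every bounded operator `b` in the commutant of `𝒩Γ`. -/
structure IsAffiliated (T : L2 Γ →ₗ.[ℂ] L2 Γ) : Prop where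
  isClosed : T.IsClosed
  dense_domain : Dense (T.domain : Set (L2 Γ))
  commutes : ∀ b ∈ (groupVN Γ).commutant, ∀ x : T.domain,
    ∃ h : b (x : L2 Γ) ∈ T.domain, T ⟨b (x : L2 Γ), h⟩ = b (T x)

end Group

section Unbounded

variable {H : Type*} [NormedAddCommGroup H] [InnerProductSpace ℂ H]

/-- The composition `S ∘ T` of unbounded operators, on the domain of all `x ∈ dom T` with
`T x ∈ dom S`. -/
def compUnbounded (S T : H →ₗ.[ℂ] H) : H →ₗ.[ℂ] H where
  domain :=
    { carrier := {x | ∃ h : x ∈ T.domain, T ⟨x, h⟩ ∈ S.domain}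
      zero_mem' := ⟨T.domain.zero_mem, by
        have h : T ⟨0, T.domain.zero_mem⟩ = 0 := T.map_zero
        rw [h]; exact S.domain.zero_mem⟩
      add_mem' := by
        rintro x y ⟨hx, hx'⟩ ⟨hy, hy'⟩
        refine ⟨T.domain.add_mem hx hy, ?_⟩
        have h : T ⟨x + y, T.domain.add_mem hx hy⟩ = T ⟨x, hx⟩ + T ⟨y, hy⟩ :=
          T.map_add ⟨x, hx⟩ ⟨y, hy⟩
        rw [h]; exact S.domain.add_mem hx' hy'
      smul_mem' := by
        rintro c x ⟨hx, hx'⟩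
        refine ⟨T.domain.smul_mem c hx, ?_⟩
        have h : T ⟨c • x, T.domain.smul_mem c hx⟩ = c • T ⟨x, hx⟩ := T.map_smul c ⟨x, hx⟩
        rw [h]; exact S.domain.smul_mem c hx' }
  toFun :=
    { toFun := fun x => S ⟨T ⟨x, x.2.1⟩, x.2.2⟩
      map_add' := by
        rintro ⟨x, hx, hx'⟩ ⟨y, hy, hy'⟩
        rw [← S.map_add]
        congr 1
        exact Subtype.ext (T.map_add ⟨x, hx⟩ ⟨y, hy⟩)
      map_smul' := by
        rintro c ⟨x, hx, hx'⟩
        rw [RingHom.id_apply, ← S.map_smul]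
        congr 1
        exact Subtype.ext (T.map_smul c ⟨x, hx⟩) }

/-- A bounded operator as an everywhere defined unbounded operator. -/
def ofBounded (T : H →L[ℂ] H) : H →ₗ.[ℂ] H := (T : H →ₗ[ℂ] H).toPMap ⊤

/-- The addition of `𝒰Γ`: the closure of the sum on the common domain. -/
def addOp (S T : H →ₗ.[ℂ] H) : H →ₗ.[ℂ] H := (S + T).closure

/-- The multiplication of `𝒰Γ`: the closure of the composition. -/
def mulOp (S T : H →ₗ.[ℂ] H) : H →ₗ.[ℂ] H := (compUnbounded S T).closure

end Unbounded

variable (Γ : Type*) [Group Γ]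

/-- `S` is a two-sided inverse of `T` in `𝒰Γ`. -/
structure IsInverseIn (T S : L2 Γ →ₗ.[ℂ] L2 Γ) : Prop where
  affiliated : IsAffiliated Γ S
  mul_right : mulOp T S = ofBounded 1
  mul_left : mulOp S T = ofBounded 1

/-- Membership in the division closure of `KΓ` in `𝒰Γ`: the smallest set of operators that contains
`KΓ`, is closed under the ring operations of `𝒰Γ`, and contains `T⁻¹` whenever it contains an
operator `T` that is invertible in `𝒰Γ`. -/
inductive InDivisionClosure (K : Subfield ℂ) : (L2 Γ →ₗ.[ℂ] L2 Γ) → Prop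
  | of (a : MonoidAlgebra K Γ) : InDivisionClosure K (ofBounded (groupRingOp a))
  | neg {T : L2 Γ →ₗ.[ℂ] L2 Γ} : InDivisionClosure K T → InDivisionClosure K (-T)
  | add {S T : L2 Γ →ₗ.[ℂ] L2 Γ} :
      InDivisionClosure K S → InDivisionClosure K T → InDivisionClosure K (addOp S T)
  | mul {S T : L2 Γ →ₗ.[ℂ] L2 Γ} :
      InDivisionClosure K S → InDivisionClosure K T → InDivisionClosure K (mulOp S T)
  | inv {T S : L2 Γ →ₗ.[ℂ] L2 Γ} :
      InDivisionClosure K T → IsInverseIn Γ T S → InDivisionClosure K S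

/-- The division closure `D_KΓ` of `KΓ` in `𝒰Γ`. -/
def DivisionClosure (K : Subfield ℂ) : Type _ :=
  {T : L2 Γ →ₗ.[ℂ] L2 Γ // InDivisionClosure Γ K T}

variable {Γ}

instance (K : Subfield ℂ) : Add (DivisionClosure Γ K) :=
  ⟨fun S T => ⟨addOp S.1 T.1, S.2.add T.2⟩⟩

instance (K : Subfield ℂ) : Mul (DivisionClosure Γ K) :=
  ⟨fun S T => ⟨mulOp S.1 T.1, S.2.mul T.2⟩⟩

/-- A type with an addition and a multiplication is a skew field if these two operations are those
of a division ring (which determine its zero, one, negatives and inverses). -/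
def IsSkewField (R : Type*) [Add R] [Mul R] : Prop :=
  ∃ F : DivisionRing R, (∀ x y : R, F.add x y = x + y) ∧ (∀ x y : R, F.mul x y = x * y)

end L2Group

end

noncomputable section

set_option linter.unusedSectionVars false

/-! ### A strong limit of resolvents -/

section Resolvent

open Filter Topology

variable {H H' : Type*} [NormedAddCommGroup H] [InnerProductSpace ℂ H] [CompleteSpace H]
  [NormedAddCommGroup H'] [InnerProductSpace ℂ H'] [CompleteSpace H']

namespace ContinuousLinearMap

/-! Everything is counted with one tool: the von Neumann dimension `famDim` of closed invariant
subspaces of `l²(Γ)^ι`. It is faithful and satisfies rank–nullity. The latter comes from the trace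
property `famTrace_comp_comm`: the traces of `ε(S*S + ε)⁻¹` and `ε(SS* + ε)⁻¹` differ by a constant,
and as `ε → 0` these operators converge strongly to the projections onto `ker S` and `ker S*`
(`famTrace_ker_add`).

Unbounded operators enter only through their graphs. Requiring `(v i, v j)` to lie in the graph of
an affiliated operator cuts the dimension by at most one (`le_famDim_coordGraph`). If such
constraints leave dimension at least one and one coordinate determines all the others, then that
coordinate has dense image (`dense_coord`). This yields closability of sums and products, the ring
axioms of `𝒰Γ`, and the invertibility of injective affiliated operators.

Atiyah implies skew field: each `T` in the division closure is read off from a linear system over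
`KΓ` with one equation less than unknowns (`Definable`). Adjoining "output = 0" makes the system
square, and its solution space embeds into `l²(Γ)` by the input, so by integrality it either has
dimension at least one, forcing `T = 0`, or vanishes, forcing `T` to be invertible
(`isUnit_of_definable`).

Skew field implies Atiyah: over a skew field a matrix factors as `A = BC` with `PB = 1` and `CQ = 1`
through `r` coordinates. Counting dimensions with these unbounded matrices gives `dim ker A ≥ d - r`
and `dim ker A ≤ d - r`, so the dimension is an integer. -/

theorem re_inner_adjoint_comp_self_add (S : H →L[ℂ] H') (ε : ℝ) (x : H) :
    (⟪(S.adjoint ∘L S + (ε : ℂ) • 1) x, x⟫_ℂ).re = ‖S x‖ ^ 2 + ε * ‖x‖ ^ 2 := by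
  have h1 : ⟪x, x⟫_ℂ = ((‖x‖ ^ 2 : ℝ) : ℂ) := by
    rw [inner_self_eq_norm_sq_to_K]; push_cast; rfl
  have h2 : ⟪S x, S x⟫_ℂ = ((‖S x‖ ^ 2 : ℝ) : ℂ) := by
    rw [inner_self_eq_norm_sq_to_K]; push_cast; rfl
  simp only [add_apply, comp_apply, smul_apply, one_apply_eq_self, inner_add_left,
    adjoint_inner_left, inner_smul_left, h1, h2, Complex.conj_ofReal]
  norm_cast

/-- Coercivity: `⟨(S*S + ε)x, x⟩ = ‖Sx‖² + ε‖x‖² ≥ ε‖x‖²`. -/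
theorem isUnit_adjoint_comp_self_add (S : H →L[ℂ] H') {ε : ℝ} (hε : 0 < ε) :
    IsUnit (S.adjoint ∘L S + (ε : ℂ) • 1) := by
  refine isUnit_of_forall_le_norm_inner_map _ (c := ⟨ε, hε.le⟩) hε fun x => ?_
  refine le_trans ?_ (Complex.re_le_norm _)
  rw [re_inner_adjoint_comp_self_add]
  change ‖x‖ ^ 2 * ε ≤ _
  nlinarith [sq_nonneg ‖S x‖]

theorem norm_smul_le_of_adjoint_comp_self_add (S : H →L[ℂ] H') (ε : ℝ) (x : H) :
    ε * ‖x‖ ≤ ‖(S.adjoint ∘L S + (ε : ℂ) • 1) x‖ := by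
  by_cases hx : x = 0
  · simp [hx]
  have hx' : 0 < ‖x‖ := norm_pos_iff.2 hx
  have h := (Complex.re_le_norm _).trans
    (norm_inner_le_norm (𝕜 := ℂ) ((S.adjoint ∘L S + (ε : ℂ) • 1) x) x)
  rw [re_inner_adjoint_comp_self_add] at h
  refine le_of_mul_le_mul_right ?_ hx'
  nlinarith [sq_nonneg ‖S x‖]

/-- The resolvent `(S* S + ε)⁻¹`. -/
def resolventAdjoint (S : H →L[ℂ] H') (ε : ℝ) : H →L[ℂ] H :=
  Ring.inverse (S.adjoint ∘L S + (ε : ℂ) • 1)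

theorem adjoint_comp_self_add_resolventAdjoint (S : H →L[ℂ] H') {ε : ℝ} (hε : 0 < ε) (x : H) :
    S.adjoint (S (S.resolventAdjoint ε x)) + (ε : ℂ) • S.resolventAdjoint ε x = x :=
  congrArg (fun T : H →L[ℂ] H => T x)
    (Ring.mul_inverse_cancel _ (S.isUnit_adjoint_comp_self_add hε))

theorem resolventAdjoint_adjoint_comp_self_add (S : H →L[ℂ] H') {ε : ℝ} (hε : 0 < ε) (x : H) :
    S.resolventAdjoint ε (S.adjoint (S x) + (ε : ℂ) • x) = x :=
  congrArg (fun T : H →L[ℂ] H => T x)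
    (Ring.inverse_mul_cancel _ (S.isUnit_adjoint_comp_self_add hε))

theorem resolventAdjoint_unique (S : H →L[ℂ] H') {ε : ℝ} (hε : 0 < ε) {x y : H}
    (h : S.adjoint (S y) + (ε : ℂ) • y = x) : S.resolventAdjoint ε x = y := by
  rw [← h, resolventAdjoint_adjoint_comp_self_add S hε]

theorem norm_smul_resolventAdjoint_le (S : H →L[ℂ] H') {ε : ℝ} (hε : 0 < ε) (x : H) :
    ‖(ε : ℂ) • S.resolventAdjoint ε x‖ ≤ ‖x‖ := by
  have h := S.norm_smul_le_of_adjoint_comp_self_add ε (S.resolventAdjoint ε x)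
  have h2 : (S.adjoint ∘L S + (ε : ℂ) • 1) (S.resolventAdjoint ε x) = x :=
    S.adjoint_comp_self_add_resolventAdjoint hε x
  rw [h2] at h
  rwa [norm_smul, Complex.norm_real, Real.norm_of_nonneg hε.le]

/-- The operators `ε(S*S + ε)⁻¹` are contractions that fix `ker S`, and they send `S*Sy` to `ε(y -
ε(S*S + ε)⁻¹y)`, which tends to zero. Since the vectors `S*Sy` are dense in `(ker S)ᗮ`, an
approximation argument suffices and no functional calculus is needed. -/
theorem tendsto_smul_resolventAdjoint (S : H →L[ℂ] H') (x : H) :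
    Tendsto (fun ε : ℝ => (ε : ℂ) • S.resolventAdjoint ε x) (𝓝[>] 0)
      (𝓝 (S.ker.starProjection x)) := by
  set p := S.ker.starProjection x with hp
  have hpk : p ∈ S.ker := Submodule.starProjection_apply_mem _ _
  -- `S*S` is self-adjoint with the same kernel as `S`, so its range is dense in `(ker S)ᗮ`.
  have hz : x - p ∈ (S.adjoint ∘L S).range.topologicalClosure := by
    have h1 : x - p ∈ S.kerᗮ := Submodule.sub_starProjection_mem_orthogonal _
    have h2 := (S.adjoint ∘L S).orthogonal_ker
    rw [ker_adjoint_comp_self] at h2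
    rw [h2] at h1
    simpa [adjoint_comp] using h1
  rw [Metric.tendsto_nhds]
  intro η hη
  obtain ⟨_, ⟨y, rfl⟩, hy⟩ := Metric.mem_closure_iff.1 hz (η / 2) (by positivity)
  -- The factor 2 accounts for the two error terms `εy` and `ε²(S*S + ε)⁻¹y`, each of norm at most
  -- `ε‖y‖`.
  have hε : ∀ᶠ ε : ℝ in 𝓝[>] 0, ε * (2 * ‖y‖) < η / 2 := by
    have : Tendsto (fun ε : ℝ => ε * (2 * ‖y‖)) (𝓝[>] 0) (𝓝 0) := by
      have h : Tendsto (fun ε : ℝ => ε * (2 * ‖y‖)) (𝓝 0) (𝓝 (0 * (2 * ‖y‖))) :=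
        tendsto_id.mul_const _
      rw [zero_mul] at h
      exact h.mono_left nhdsWithin_le_nhds
    exact this.eventually_lt_const (by positivity)
  filter_upwards [hε, self_mem_nhdsWithin] with ε h1 hpos
  have hpos : 0 < ε := hpos
  have e1 : (ε : ℂ) • S.resolventAdjoint ε p = p := by
    rw [← map_smul]
    refine S.resolventAdjoint_unique hpos ?_
    have : S p = 0 := hpk
    rw [this, map_zero, zero_add]
  have e2 : S.resolventAdjoint ε ((S.adjoint ∘L S) y) = y - (ε : ℂ) • S.resolventAdjoint ε y := by
    have := S.resolventAdjoint_adjoint_comp_self_add hpos y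
    rw [map_add, map_smul] at this
    exact eq_sub_of_add_eq this
  have e3 : (ε : ℂ) • S.resolventAdjoint ε x - p =
      (ε : ℂ) • S.resolventAdjoint ε (x - p - (S.adjoint ∘L S) y) +
        ((ε : ℂ) • y - (ε : ℂ) • (ε : ℂ) • S.resolventAdjoint ε y) := by
    have e4 : (ε : ℂ) • S.resolventAdjoint ε (x - p - (S.adjoint ∘L S) y) =
        (ε : ℂ) • S.resolventAdjoint ε x - (ε : ℂ) • S.resolventAdjoint ε p -
          (ε : ℂ) • S.resolventAdjoint ε ((S.adjoint ∘L S) y) := by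
      rw [map_sub, map_sub, smul_sub, smul_sub]
    rw [e4, e1, e2, smul_sub]
    abel
  have hn : ‖(ε : ℂ)‖ = ε := by rw [Complex.norm_real, Real.norm_of_nonneg hpos.le]
  rw [dist_eq_norm, e3]
  calc _ ≤ ‖(ε : ℂ) • S.resolventAdjoint ε (x - p - (S.adjoint ∘L S) y)‖ +
        (‖(ε : ℂ) • y‖ + ‖(ε : ℂ) • (ε : ℂ) • S.resolventAdjoint ε y‖) :=
        (norm_add_le _ _).trans (by gcongr; exact norm_sub_le _ _)
    _ ≤ ‖x - p - (S.adjoint ∘L S) y‖ + (ε * ‖y‖ + ε * ‖y‖) := by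
        gcongr
        · exact S.norm_smul_resolventAdjoint_le hpos _
        · rw [norm_smul, hn]
        · rw [norm_smul, hn]
          gcongr
          exact S.norm_smul_resolventAdjoint_le hpos _
    _ < η := by
        rw [← dist_eq_norm]
        have : dist (x - p) ((S.adjoint ∘L S) y) < η / 2 := hy
        linarith

/-- Expresses the resolvent of `SS*` through that of `S*S`, so that the two traces become
comparable. -/
theorem adjoint_resolventAdjoint_adjoint (S : H →L[ℂ] H') {ε : ℝ} (hε : 0 < ε) (x : H') :
    S.adjoint.resolventAdjoint ε x = (ε : ℂ)⁻¹ • (x - S (S.resolventAdjoint ε (S.adjoint x))) := by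
  have hε' : (ε : ℂ) ≠ 0 := by exact_mod_cast hε.ne'
  refine S.adjoint.resolventAdjoint_unique hε ?_
  have h := S.adjoint_comp_self_add_resolventAdjoint hε (S.adjoint x)
  have h2 : S.adjoint (S (S.resolventAdjoint ε (S.adjoint x))) =
    S.adjoint x - (ε : ℂ) • S.resolventAdjoint ε (S.adjoint x) := eq_sub_of_add_eq h
  rw [adjoint_adjoint, map_smul, map_sub, h2, sub_sub_cancel, smul_smul, inv_mul_cancel₀ hε',
    one_smul, smul_smul, mul_inv_cancel₀ hε', one_smul]
  abel

end ContinuousLinearMap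

end Resolvent

namespace L2Group

/-! ### Equivariant operators and their trace -/

/-- The Hilbert space of families of elements of `l²(Γ)` indexed by a finite type. -/
abbrev L2Fam (Γ : Type*) (ι : Type*) : Type _ := PiLp 2 fun _ : ι => L2 Γ

section Fam

variable {Γ : Type*} [Group Γ] {ι κ μ : Type*} [Fintype ι] [Fintype κ] [Fintype μ]

/-- The operator between families given by a matrix of operators. -/
def entriesOp (a : κ → ι → L2 Γ →L[ℂ] L2 Γ) : L2Fam Γ ι →L[ℂ] L2Fam Γ κ :=
  (PiLp.continuousLinearEquiv 2 ℂ fun _ : κ => L2 Γ).symm.toContinuousLinearMap ∘L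
    ContinuousLinearMap.pi fun k => ∑ i, a k i ∘L PiLp.proj 2 (fun _ : ι => L2 Γ) i

@[simp] theorem entriesOp_apply (a : κ → ι → L2 Γ →L[ℂ] L2 Γ) (v : L2Fam Γ ι) (k : κ) :
    entriesOp a v k = ∑ i, a k i (v i) := by
  simp [entriesOp]

/-- An operator of `l²(Γ)` applied to each member of a family. -/
def diagOp (b : L2 Γ →L[ℂ] L2 Γ) : L2Fam Γ ι →L[ℂ] L2Fam Γ ι :=
  (PiLp.continuousLinearEquiv 2 ℂ fun _ : ι => L2 Γ).symm.toContinuousLinearMap ∘L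
    ContinuousLinearMap.pi fun k => b ∘L PiLp.proj 2 (fun _ : ι => L2 Γ) k

@[simp] theorem diagOp_apply (b : L2 Γ →L[ℂ] L2 Γ) (v : L2Fam Γ ι) (k : ι) :
    diagOp b v k = b (v k) := by
  simp [diagOp]

@[simp] theorem rightTranslation_apply (g h : Γ) (f : L2 Γ) :
    rightTranslation g f h = f (h * g⁻¹) := rfl

@[simp] theorem leftTranslation_apply (g h : Γ) (f : L2 Γ) :
    leftTranslation g f h = f (g⁻¹ * h) := rfl

variable (ι) in
/-- Right translation of families. -/
abbrev famTranslation (g : Γ) : L2Fam Γ ι →L[ℂ] L2Fam Γ ι := diagOp (rightTranslation g)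

theorem inner_famTranslation (g : Γ) (v w : L2Fam Γ ι) :
    ⟪famTranslation ι g v, w⟫_ℂ = ⟪v, famTranslation ι g⁻¹ w⟫_ℂ := by
  simp only [PiLp.inner_apply, diagOp_apply]
  refine Finset.sum_congr rfl fun i _ => ?_
  rw [← star_rightTranslation, ContinuousLinearMap.star_eq_adjoint,
    ContinuousLinearMap.adjoint_inner_right]

theorem inner_famTranslation' (g : Γ) (v w : L2Fam Γ ι) :
    ⟪v, famTranslation ι g w⟫_ℂ = ⟪famTranslation ι g⁻¹ v, w⟫_ℂ := by
  rw [inner_famTranslation, inv_inv]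

/-- Operators between families that commute with right translations. -/
def Equivariant (A : L2Fam Γ ι →L[ℂ] L2Fam Γ κ) : Prop :=
  ∀ g v, A (famTranslation ι g v) = famTranslation κ g (A v)

theorem Equivariant.comp {A : L2Fam Γ κ →L[ℂ] L2Fam Γ μ} {B : L2Fam Γ ι →L[ℂ] L2Fam Γ κ}
    (hA : Equivariant A) (hB : Equivariant B) : Equivariant (A ∘L B) := fun g v => by
  simp only [ContinuousLinearMap.comp_apply]
  rw [hB g v, hA]

theorem Equivariant.adjoint {A : L2Fam Γ ι →L[ℂ] L2Fam Γ κ} (hA : Equivariant A) :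
    Equivariant A.adjoint := fun g v => by
  refine ext_inner_left ℂ fun w => ?_
  rw [ContinuousLinearMap.adjoint_inner_right, inner_famTranslation', inner_famTranslation',
    ContinuousLinearMap.adjoint_inner_right, hA]

theorem Equivariant.one : Equivariant (1 : L2Fam Γ ι →L[ℂ] L2Fam Γ ι) := fun _ _ => rfl

theorem Equivariant.sub {A B : L2Fam Γ ι →L[ℂ] L2Fam Γ κ} (hA : Equivariant A)
    (hB : Equivariant B) : Equivariant (A - B) := fun g v => by
  simp only [sub_apply, map_sub]
  rw [hA g v, hB g v]

theorem Equivariant.resolventAdjoint {S : L2Fam Γ ι →L[ℂ] L2Fam Γ κ} (hS : Equivariant S)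
    {ε : ℝ} (hε : 0 < ε) : Equivariant (S.resolventAdjoint ε) := fun g v => by
  refine S.resolventAdjoint_unique hε ?_
  rw [hS, hS.adjoint]
  conv_rhs => rw [← S.adjoint_comp_self_add_resolventAdjoint hε v]
  rw [map_add, map_smul]

open Classical in
/-- The family whose `i`-th member is the characteristic function of `1 ∈ Γ` and whose other members
vanish. -/
def baseVec (Γ : Type*) [Group Γ] {ι : Type*} (i : ι) : L2Fam Γ ι :=
  WithLp.toLp 2 (Pi.single i (lp.single 2 (1 : Γ) (1 : ℂ)))

theorem inner_baseVec (v : L2Fam Γ ι) (i : ι) : ⟪baseVec Γ i, v⟫_ℂ = v i 1 := by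
  classical
  rw [PiLp.inner_apply, Finset.sum_eq_single i]
  · simp [baseVec, lp.inner_single_left]
  · intro j _ hj
    simp [baseVec, hj]
  · simp

theorem inner_famTranslation_baseVec (v : L2Fam Γ ι) (i : ι) (g : Γ) :
    ⟪famTranslation ι g (baseVec Γ i), v⟫_ℂ = v i g := by
  rw [inner_famTranslation, inner_baseVec]
  simp

/-- The trace of an operator on families. -/
def famTrace (A : L2Fam Γ ι →L[ℂ] L2Fam Γ ι) : ℂ := ∑ i, ⟪baseVec Γ i, A (baseVec Γ i)⟫_ℂ

/-- By equivariance the coefficients of `A* e_i` are conjugates of coefficients of the vectors `A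
e_k` at inverse group elements. The resulting sum is symmetric in `A` and `B` up to `g ↦ g⁻¹`, which
is the trace property. -/
theorem inner_baseVec_comp {A : L2Fam Γ κ →L[ℂ] L2Fam Γ ι} (hA : Equivariant A)
    (B : L2Fam Γ ι →L[ℂ] L2Fam Γ κ) (i : ι) :
    ⟪baseVec Γ i, A (B (baseVec Γ i))⟫_ℂ =
      ∑ k, ∑' g : Γ, B (baseVec Γ i) k g * A (baseVec Γ k) i g⁻¹ := by
  rw [← ContinuousLinearMap.adjoint_inner_left, PiLp.inner_apply]
  refine Finset.sum_congr rfl fun k _ => ?_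
  rw [lp.inner_eq_tsum]
  refine tsum_congr fun g => ?_
  rw [RCLike.inner_apply]
  congr 1
  rw [← inner_famTranslation_baseVec (A.adjoint _), inner_conj_symm,
    ContinuousLinearMap.adjoint_inner_left, hA, inner_famTranslation', inner_famTranslation_baseVec]

theorem famTrace_comp_comm {A : L2Fam Γ κ →L[ℂ] L2Fam Γ ι} {B : L2Fam Γ ι →L[ℂ] L2Fam Γ κ}
    (hA : Equivariant A) (hB : Equivariant B) : famTrace (A ∘L B) = famTrace (B ∘L A) := by
  simp only [famTrace, ContinuousLinearMap.comp_apply, inner_baseVec_comp hA,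
    inner_baseVec_comp hB]
  rw [Finset.sum_comm]
  refine Finset.sum_congr rfl fun k _ => Finset.sum_congr rfl fun i _ => ?_
  rw [← (Equiv.inv Γ).tsum_eq]
  refine tsum_congr fun g => ?_
  simp [mul_comm]

theorem famTrace_one : famTrace (1 : L2Fam Γ ι →L[ℂ] L2Fam Γ ι) = Fintype.card ι := by
  classical
  simp [famTrace, baseVec]

theorem famTrace_sub (A B : L2Fam Γ ι →L[ℂ] L2Fam Γ ι) :
    famTrace (A - B) = famTrace A - famTrace B := by
  simp [famTrace]

open Filter Topology in
theorem tendsto_famTrace_resolventAdjoint (S : L2Fam Γ ι →L[ℂ] L2Fam Γ κ) :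
    Tendsto (fun ε : ℝ => famTrace ((ε : ℂ) • S.resolventAdjoint ε)) (𝓝[>] 0)
      (𝓝 (famTrace S.ker.starProjection)) :=
  tendsto_finsetSum _ fun _ _ => tendsto_const_nhds.inner (S.tendsto_smul_resolventAdjoint _)

open Filter Topology in
-- Rank–nullity in trace form. With `R = (S*S + ε)⁻¹` the two regularized projections are `1 -
-- S*(SR)` and `1 - (SR)S*`. By the trace property they differ in trace only through the traces of
-- the identities. Then let `ε → 0`.
theorem famTrace_ker_add {S : L2Fam Γ ι →L[ℂ] L2Fam Γ κ} (hS : Equivariant S) :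
    famTrace S.ker.starProjection + Fintype.card κ =
      famTrace S.adjoint.ker.starProjection + Fintype.card ι := by
  have key : ∀ {ε : ℝ}, 0 < ε →
      famTrace ((ε : ℂ) • S.resolventAdjoint ε) + Fintype.card κ =
        famTrace ((ε : ℂ) • S.adjoint.resolventAdjoint ε) + Fintype.card ι := by
    intro ε hε
    have e1 : (ε : ℂ) • S.resolventAdjoint ε = 1 - S.adjoint ∘L (S ∘L S.resolventAdjoint ε) := by
      ext1 x
      exact eq_sub_of_add_eq' (S.adjoint_comp_self_add_resolventAdjoint hε x)
    have e2 : (ε : ℂ) • S.adjoint.resolventAdjoint ε =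
        1 - (S ∘L S.resolventAdjoint ε) ∘L S.adjoint := by
      ext1 x
      have hε' : (ε : ℂ) ≠ 0 := by exact_mod_cast hε.ne'
      rw [smul_apply, S.adjoint_resolventAdjoint_adjoint hε, smul_smul,
        mul_inv_cancel₀ hε', one_smul]
      rfl
    rw [e1, e2, famTrace_sub, famTrace_sub, famTrace_one, famTrace_one,
      famTrace_comp_comm hS.adjoint (hS.comp (hS.resolventAdjoint hε))]
    ring
  refine tendsto_nhds_unique_of_eventuallyEq ((tendsto_famTrace_resolventAdjoint S).add_const _)
    ((tendsto_famTrace_resolventAdjoint S.adjoint).add_const _) ?_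
  filter_upwards [self_mem_nhdsWithin] with ε hε
  exact key hε

/-! ### The dimension of invariant subspaces -/

/-- Closed subspaces of families that are invariant under right translations. -/
structure IsClosedInvariant (V : Submodule ℂ (L2Fam Γ ι)) : Prop where
  isClosed : IsClosed (V : Set (L2Fam Γ ι))
  translate_mem : ∀ g, ∀ v ∈ V, famTranslation ι g v ∈ V

/-- The dimension of (the closure of) a subspace of families. -/
def famDim (V : Submodule ℂ (L2Fam Γ ι)) : ℝ :=
  ∑ i, ‖V.topologicalClosure.starProjection (baseVec Γ i)‖ ^ 2

theorem inner_starProjection_self {H : Type*} [NormedAddCommGroup H] [InnerProductSpace ℂ H]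
    (V : Submodule ℂ H) [V.HasOrthogonalProjection] (x : H) :
    ⟪x, V.starProjection x⟫_ℂ = ((‖V.starProjection x‖ ^ 2 : ℝ) : ℂ) := by
  rw [← Submodule.starProjection_eq_self_iff.2 (V.starProjection_apply_mem x),
    ← Submodule.inner_starProjection_left_eq_right,
    Submodule.starProjection_eq_self_iff.2 (V.starProjection_apply_mem x),
    inner_self_eq_norm_sq_to_K]
  push_cast
  rfl

theorem famTrace_starProjection (V : Submodule ℂ (L2Fam Γ ι)) [V.HasOrthogonalProjection]
    (hV : IsClosed (V : Set (L2Fam Γ ι))) :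
    famTrace V.starProjection = famDim V := by
  have h : V.topologicalClosure = V := hV.submodule_topologicalClosure_eq
  simp only [famTrace, famDim, h, inner_starProjection_self]
  push_cast
  rfl

theorem famDim_nonneg (V : Submodule ℂ (L2Fam Γ ι)) : 0 ≤ famDim V :=
  Finset.sum_nonneg fun _ _ => sq_nonneg _

theorem famDim_topologicalClosure (V : Submodule ℂ (L2Fam Γ ι)) :
    famDim V.topologicalClosure = famDim V := by
  have h : V.topologicalClosure.topologicalClosure = V.topologicalClosure :=
    V.isClosed_topologicalClosure.submodule_topologicalClosure_eq
  simp only [famDim, h]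

end Fam

end L2Group

namespace L2Group

section Dim

variable {Γ : Type*} [Group Γ] {ι κ μ : Type*} [Fintype ι] [Fintype κ] [Fintype μ]

theorem isClosed_ker_clm {E F : Type*} [NormedAddCommGroup E] [NormedSpace ℂ E]
    [NormedAddCommGroup F] [NormedSpace ℂ F] (f : E →L[ℂ] F) :
    IsClosed (f.ker : Set E) := f.isClosed_ker

/-- `ker S*` is the orthogonal complement of the range. The range need not be closed, as `famDim`
measures its closure. -/
theorem famDim_ker_add_famDim_range {S : L2Fam Γ ι →L[ℂ] L2Fam Γ κ} (hS : Equivariant S) :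
    famDim S.ker + famDim S.range = Fintype.card ι := by
  have h := famTrace_ker_add hS
  have h2 : S.adjoint.ker.starProjection = 1 - S.range.topologicalClosure.starProjection := by
    have h3 : S.adjoint.ker = S.range.topologicalClosureᗮ := by
      rw [Submodule.orthogonal_closure, S.orthogonal_range]
    simp only [h3, Submodule.starProjection_orthogonal']
  rw [h2, famTrace_sub, famTrace_one, famTrace_starProjection _ (isClosed_ker_clm S),
    famTrace_starProjection _ S.range.isClosed_topologicalClosure, famDim_topologicalClosure] at h
  have h4 : ((famDim S.ker + famDim S.range : ℝ) : ℂ) = ((Fintype.card ι : ℝ) : ℂ) := by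
    push_cast
    linear_combination h
  exact_mod_cast h4

theorem famDim_top : famDim (⊤ : Submodule ℂ (L2Fam Γ ι)) = Fintype.card ι := by
  have h := famTrace_starProjection (⊤ : Submodule ℂ (L2Fam Γ ι)) isClosed_univ
  rw [Submodule.starProjection_top', famTrace_one] at h
  exact_mod_cast h.symm

/-! ### Dimension calculus for closed invariant subspaces -/

namespace IsClosedInvariant

theorem top : IsClosedInvariant (⊤ : Submodule ℂ (L2Fam Γ ι)) :=
  ⟨isClosed_univ, fun _ _ _ => trivial⟩

theorem inf {V W : Submodule ℂ (L2Fam Γ ι)} (hV : IsClosedInvariant V)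
    (hW : IsClosedInvariant W) : IsClosedInvariant (V ⊓ W) :=
  ⟨hV.isClosed.inter hW.isClosed,
    fun g v hv => ⟨hV.translate_mem g v hv.1, hW.translate_mem g v hv.2⟩⟩

theorem iInf {σ : Sort*} {V : σ → Submodule ℂ (L2Fam Γ ι)} (hV : ∀ s, IsClosedInvariant (V s)) :
    IsClosedInvariant (⨅ s, V s) := by
  refine ⟨?_, fun g v hv => ?_⟩
  · rw [Submodule.coe_iInf]
    exact isClosed_iInter fun s => (hV s).isClosed
  · rw [Submodule.mem_iInf] at hv ⊢
    exact fun s => (hV s).translate_mem g v (hv s)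

theorem ker {S : L2Fam Γ ι →L[ℂ] L2Fam Γ κ} (hS : Equivariant S) : IsClosedInvariant S.ker :=
  ⟨isClosed_ker_clm S, fun g v hv => by
    have hv : S v = 0 := hv
    change S _ = 0
    rw [hS, hv, map_zero]⟩

theorem closure_map {V : Submodule ℂ (L2Fam Γ ι)} (hV : IsClosedInvariant V)
    {f : L2Fam Γ ι →L[ℂ] L2Fam Γ κ} (hf : Equivariant f) :
    IsClosedInvariant (V.map f.toLinearMap).topologicalClosure := by
  refine ⟨Submodule.isClosed_topologicalClosure _, fun g v hv => ?_⟩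
  refine map_mem_closure (famTranslation κ g).continuous hv ?_
  rintro _ ⟨w, hw, rfl⟩
  exact ⟨_, hV.translate_mem g w hw, hf g w⟩

theorem hasOrthogonalProjection {V : Submodule ℂ (L2Fam Γ ι)} (hV : IsClosedInvariant V) :
    V.HasOrthogonalProjection := by
  have := hV.isClosed.completeSpace_coe
  infer_instance

theorem equivariant_starProjection {V : Submodule ℂ (L2Fam Γ ι)} (hV : IsClosedInvariant V)
    [V.HasOrthogonalProjection] : Equivariant V.starProjection := fun g v => by
  refine Submodule.eq_starProjection_of_mem_of_inner_eq_zero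
    (hV.translate_mem g _ (V.starProjection_apply_mem v)) fun w hw => ?_
  rw [← map_sub, inner_famTranslation]
  exact V.starProjection_inner_eq_zero v _ (hV.translate_mem _ w hw)

/-- Rank–nullity on `V`, obtained from the everywhere defined operator `f ∘ pr_V`, whose kernel is
the orthogonal sum of `Vᗮ` and `V ⊓ ker f`. -/
theorem famDim_eq {V : Submodule ℂ (L2Fam Γ ι)} (hV : IsClosedInvariant V)
    {f : L2Fam Γ ι →L[ℂ] L2Fam Γ κ} (hf : Equivariant f) :
    famDim V = famDim (V ⊓ f.ker) + famDim (V.map f.toLinearMap) := by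
  have := hV.hasOrthogonalProjection
  have hZ : IsClosedInvariant (V ⊓ f.ker) := hV.inf (ker hf)
  have := hZ.hasOrthogonalProjection
  set Z := V ⊓ f.ker with hZdef
  set S := f ∘L V.starProjection with hS
  have hSe : Equivariant S := hf.comp hV.equivariant_starProjection
  have hrange : S.range = V.map f.toLinearMap := by
    ext w
    constructor
    · rintro ⟨v, rfl⟩
      exact ⟨_, V.starProjection_apply_mem v, rfl⟩
    · rintro ⟨v, hv, rfl⟩
      exact ⟨v, congrArg f (Submodule.starProjection_eq_self_iff.2 hv)⟩
  have hker : S.ker.starProjection = 1 - V.starProjection + Z.starProjection := by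
    ext1 x
    have hZx : Z.starProjection x ∈ Z := Z.starProjection_apply_mem x
    refine Submodule.eq_starProjection_of_mem_of_inner_eq_zero ?_ fun w hw => ?_
    · change f (V.starProjection (x - V.starProjection x + Z.starProjection x)) = 0
      rw [map_add, map_sub, Submodule.starProjection_eq_self_iff.2 (V.starProjection_apply_mem x),
        sub_self, zero_add, Submodule.starProjection_eq_self_iff.2 hZx.1]
      exact hZx.2
    · have hw : f (V.starProjection w) = 0 := hw
      have h1 : V.starProjection w ∈ Z := ⟨V.starProjection_apply_mem w, hw⟩
      have h2 : Z.starProjection w = V.starProjection w := by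
        refine Submodule.eq_starProjection_of_mem_of_inner_eq_zero h1 fun z hz => ?_
        exact V.starProjection_inner_eq_zero w z hz.1
      have h3 : x - (1 - V.starProjection + Z.starProjection : L2Fam Γ ι →L[ℂ] L2Fam Γ ι) x =
          V.starProjection x - Z.starProjection x := by
        change x - (x - V.starProjection x + Z.starProjection x) = _
        abel
      rw [h3, inner_sub_left, Submodule.inner_starProjection_left_eq_right,
        Submodule.inner_starProjection_left_eq_right, h2, sub_self]
  have h1 := famDim_ker_add_famDim_range hSe
  have h2 : (famDim S.ker : ℂ) = Fintype.card ι - famDim V + famDim Z := by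
    rw [← famTrace_starProjection _ (isClosed_ker_clm S), ← famTrace_starProjection _ hV.isClosed,
      ← famTrace_starProjection _ hZ.isClosed, hker, ← sub_neg_eq_add, famTrace_sub, famTrace_sub,
      famTrace_one]
    simp [famTrace]
  have h3 : famDim S.ker = Fintype.card ι - famDim V + famDim Z := by exact_mod_cast h2
  rw [← hrange]
  linarith

/-- Faithfulness: dimension zero means that `pr_V` kills every base vector, hence by equivariance
every translate of one, and pairing with these translates gives all coefficients of a vector. -/
theorem eq_bot_of_famDim_le {V : Submodule ℂ (L2Fam Γ ι)} (hV : IsClosedInvariant V)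
    (h : famDim V ≤ 0) : V = ⊥ := by
  have := hV.hasOrthogonalProjection
  have hV' : V.topologicalClosure = V := hV.isClosed.submodule_topologicalClosure_eq
  have h0 : ∀ i, V.starProjection (baseVec Γ i) = 0 := by
    have h := (Finset.sum_eq_zero_iff_of_nonneg fun _ _ => sq_nonneg _).1
      (le_antisymm h (famDim_nonneg V))
    intro i
    have := h i (Finset.mem_univ i)
    simpa only [hV', sq_eq_zero_iff, norm_eq_zero] using this
  rw [eq_bot_iff]
  intro v hv
  rw [← Submodule.starProjection_eq_self_iff.2 hv, Submodule.mem_bot]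
  ext i g
  rw [← inner_famTranslation_baseVec, ← Submodule.inner_starProjection_left_eq_right,
    hV.equivariant_starProjection, h0, map_zero, inner_zero_left]
  rfl

theorem famDim_mono {V W : Submodule ℂ (L2Fam Γ ι)} (hV : IsClosedInvariant V)
    (hW : IsClosedInvariant W) (h : V ≤ W) : famDim V ≤ famDim W := by
  have := hV.hasOrthogonalProjection
  have h1 := hW.famDim_eq (Equivariant.one.sub hV.equivariant_starProjection)
  have h2 : (1 - V.starProjection : L2Fam Γ ι →L[ℂ] L2Fam Γ ι).ker = V := by
    ext x
    change x - V.starProjection x = 0 ↔ _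
    rw [sub_eq_zero, eq_comm, Submodule.starProjection_eq_self_iff]
  rw [h2, inf_eq_right.2 h] at h1
  rw [h1]
  linarith [famDim_nonneg (W.map (1 - V.starProjection : L2Fam Γ ι →L[ℂ] L2Fam Γ ι).toLinearMap)]

/-- Rank–nullity for `1 - pr_V` on `W`: the kernel is `V`, so the image has dimension zero and
vanishes. -/
theorem eq_of_le_of_famDim_le {V W : Submodule ℂ (L2Fam Γ ι)} (hV : IsClosedInvariant V)
    (hW : IsClosedInvariant W) (h : V ≤ W) (hd : famDim W ≤ famDim V) : V = W := by
  have := hV.hasOrthogonalProjection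
  have he := Equivariant.one.sub hV.equivariant_starProjection
  have h1 := hW.famDim_eq he
  have h2 : (1 - V.starProjection : L2Fam Γ ι →L[ℂ] L2Fam Γ ι).ker = V := by
    ext x
    change x - V.starProjection x = 0 ↔ _
    rw [sub_eq_zero, eq_comm, Submodule.starProjection_eq_self_iff]
  rw [h2, inf_eq_right.2 h] at h1
  have h3 := (hW.closure_map he).eq_bot_of_famDim_le
    (by rw [famDim_topologicalClosure]; linarith)
  refine le_antisymm h fun x hx => ?_
  rw [← h2]
  have h4 := Submodule.le_topologicalClosure
    (W.map (1 - V.starProjection : L2Fam Γ ι →L[ℂ] L2Fam Γ ι).toLinearMap) ⟨x, hx, rfl⟩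
  rw [h3] at h4
  exact h4

theorem famDim_le_card {V : Submodule ℂ (L2Fam Γ ι)} (hV : IsClosedInvariant V) :
    famDim V ≤ Fintype.card ι := by
  rw [← famDim_top (Γ := Γ)]
  exact hV.famDim_mono top le_top

theorem famDim_map_le {V : Submodule ℂ (L2Fam Γ ι)} (hV : IsClosedInvariant V)
    {f : L2Fam Γ ι →L[ℂ] L2Fam Γ κ} (hf : Equivariant f) :
    famDim (V.map f.toLinearMap) ≤ famDim V := by
  rw [hV.famDim_eq hf]
  linarith [famDim_nonneg (V ⊓ f.ker)]

theorem famDim_map_of_injOn {V : Submodule ℂ (L2Fam Γ ι)} (hV : IsClosedInvariant V)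
    {f : L2Fam Γ ι →L[ℂ] L2Fam Γ κ} (hf : Equivariant f) (hinj : ∀ v ∈ V, f v = 0 → v = 0) :
    famDim (V.map f.toLinearMap) = famDim V := by
  have h : V ⊓ f.ker = ⊥ := by
    rw [eq_bot_iff]
    rintro v ⟨hv, hv'⟩
    exact hinj v hv hv'
  have h0 : famDim (⊥ : Submodule ℂ (L2Fam Γ ι)) = 0 := by
    have h1 := famDim_ker_add_famDim_range (Equivariant.one (Γ := Γ) (ι := ι))
    have h2 : (1 : L2Fam Γ ι →L[ℂ] L2Fam Γ ι).ker = ⊥ := LinearMap.ker_id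
    have h3 : (1 : L2Fam Γ ι →L[ℂ] L2Fam Γ ι).range = ⊤ := LinearMap.range_id
    rw [h2, h3, famDim_top] at h1
    linarith
  rw [hV.famDim_eq hf, h, h0, zero_add]

/-- `V ⊓ W` is the kernel of `1 - pr_W` on `V`, and the image of `V` is no larger than that of the
whole space, whose dimension is the codimension of `W`. -/
theorem famDim_inf {V W : Submodule ℂ (L2Fam Γ ι)} (hV : IsClosedInvariant V)
    (hW : IsClosedInvariant W) : famDim V + famDim W - Fintype.card ι ≤ famDim (V ⊓ W) := by
  have := hW.hasOrthogonalProjection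
  have he := Equivariant.one.sub hW.equivariant_starProjection
  have h2 : (1 - W.starProjection : L2Fam Γ ι →L[ℂ] L2Fam Γ ι).ker = W := by
    ext x
    change x - W.starProjection x = 0 ↔ _
    rw [sub_eq_zero, eq_comm, Submodule.starProjection_eq_self_iff]
  have h1 := hV.famDim_eq he
  have h3 := (top (Γ := Γ) (ι := ι)).famDim_eq he
  rw [h2] at h1 h3
  rw [top_inf_eq, famDim_top] at h3
  have h4 := (hV.closure_map he).famDim_mono (top.closure_map he)
    (Submodule.topologicalClosure_mono (Submodule.map_mono le_top))
  rw [famDim_topologicalClosure, famDim_topologicalClosure] at h4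
  linarith

theorem famDim_iInf {σ : Type*} [Fintype σ] {V : σ → Submodule ℂ (L2Fam Γ ι)}
    (hV : ∀ s, IsClosedInvariant (V s)) (hd : ∀ s, Fintype.card ι - 1 ≤ famDim (V s)) :
    (Fintype.card ι : ℝ) - Fintype.card σ ≤ famDim (⨅ s, V s) := by
  classical
  suffices h : ∀ t : Finset σ, IsClosedInvariant (⨅ s ∈ t, V s) ∧
      (Fintype.card ι : ℝ) - t.card ≤ famDim (⨅ s ∈ t, V s) by
    simpa using (h Finset.univ).2
  intro t
  induction t using Finset.induction_on with
  | empty => simpa [famDim_top] using top (Γ := Γ) (ι := ι)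
  | insert a t ha ih =>
    rw [Finset.iInf_insert, Finset.card_insert_of_notMem ha]
    refine ⟨(hV a).inf ih.1, ?_⟩
    have h1 := (hV a).famDim_inf ih.1
    have h2 := hd a
    push_cast
    linarith [ih.2]

end IsClosedInvariant

theorem le_famDim_ker {S : L2Fam Γ ι →L[ℂ] L2Fam Γ κ} (hS : Equivariant S) :
    (Fintype.card ι : ℝ) - Fintype.card κ ≤ famDim S.ker := by
  have h1 := famDim_ker_add_famDim_range hS
  have h2 := (IsClosedInvariant.top.closure_map hS).famDim_le_card
  rw [famDim_topologicalClosure, ← LinearMap.range_eq_map] at h2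
  linarith

/-! ### Coordinates of families -/

/-- The operator that selects members of a family. -/
def selectOp (e : κ → ι) : L2Fam Γ ι →L[ℂ] L2Fam Γ κ :=
  (PiLp.continuousLinearEquiv 2 ℂ fun _ : κ => L2 Γ).symm.toContinuousLinearMap ∘L
    ContinuousLinearMap.pi fun k => PiLp.proj 2 (fun _ : ι => L2 Γ) (e k)

@[simp] theorem selectOp_apply (e : κ → ι) (v : L2Fam Γ ι) (k : κ) :
    selectOp e v k = v (e k) := by
  simp [selectOp]

theorem equivariant_selectOp (e : κ → ι) :
    Equivariant (selectOp e : L2Fam Γ ι →L[ℂ] L2Fam Γ κ) := fun g v => by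
  ext1 k
  simp

theorem equivariant_entriesOp {a : κ → ι → L2 Γ →L[ℂ] L2 Γ}
    (ha : ∀ k i, a k i ∈ groupVN Γ) : Equivariant (entriesOp a) := fun g v => by
  ext1 k
  simp only [entriesOp_apply, diagOp_apply, map_sum]
  refine Finset.sum_congr rfl fun i _ => ?_
  exact congrArg (fun T : L2 Γ →L[ℂ] L2 Γ => T (v i)) ((mem_groupVN_iff _).1 (ha k i) g).symm

theorem continuous_coord (i : ι) : Continuous fun v : L2Fam Γ ι => v i :=
  (PiLp.proj (𝕜 := ℂ) 2 (fun _ : ι => L2 Γ) i).continuous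

namespace IsClosedInvariant

theorem famDim_le_one {V : Submodule ℂ (L2Fam Γ ι)} (hV : IsClosedInvariant V) (x : ι)
    (hinj : ∀ v ∈ V, v x = 0 → v = 0) : famDim V ≤ 1 := by
  have he := equivariant_selectOp (Γ := Γ) (fun _ : Unit => x)
  rw [← hV.famDim_map_of_injOn he fun v hv h => hinj v hv ?_]
  · simpa [famDim_topologicalClosure] using (hV.closure_map he).famDim_le_card
  · simpa using congrArg (fun w : L2Fam Γ Unit => w ()) h

/-- The source of all density statements below: an injective coordinate preserves dimension, so the
closure of its image has full dimension in `l²(Γ)`. -/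
theorem dense_coord {V : Submodule ℂ (L2Fam Γ ι)} (hV : IsClosedInvariant V) (x : ι)
    (hinj : ∀ v ∈ V, v x = 0 → v = 0) (hd : 1 ≤ famDim V) :
    Dense {f : L2 Γ | ∃ v ∈ V, v x = f} := by
  have he := equivariant_selectOp (Γ := Γ) (fun _ : Unit => x)
  have h1 := hV.famDim_map_of_injOn he fun v hv h => hinj v hv
    (by simpa using congrArg (fun w : L2Fam Γ Unit => w ()) h)
  have h2 := (hV.closure_map he).eq_of_le_of_famDim_le top le_top
    (by rw [famDim_top, famDim_topologicalClosure, h1]; simpa using hd)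
  have h3 := (Submodule.dense_iff_topologicalClosure_eq_top.2 h2)
  have h4 : Function.Surjective fun v : L2Fam Γ Unit => v () :=
    fun f => ⟨WithLp.toLp 2 fun _ => f, rfl⟩
  refine (h4.denseRange.dense_image (continuous_coord ()) h3).mono ?_
  rintro _ ⟨_, ⟨v, hv, rfl⟩, rfl⟩
  exact ⟨v, hv, by simp⟩

theorem one_le_famDim_map {V : Submodule ℂ (L2Fam Γ ι)} (x : ι)
    (hd : Dense {f : L2 Γ | ∃ v ∈ V, v x = f}) :
    1 ≤ famDim (V.map (selectOp (Γ := Γ) fun _ : Unit => x).toLinearMap) := by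
  have h4 : Function.Surjective fun f : L2 Γ => (WithLp.toLp 2 fun _ => f : L2Fam Γ Unit) :=
    fun v => ⟨v (), rfl⟩
  have h5 : Continuous fun f : L2 Γ => (WithLp.toLp 2 fun _ => f : L2Fam Γ Unit) :=
    (PiLp.continuous_toLp 2 _).comp (continuous_pi fun _ => continuous_id)
  have h2 : (V.map (selectOp (Γ := Γ) fun _ : Unit => x).toLinearMap).topologicalClosure = ⊤ := by
    rw [← Submodule.dense_iff_topologicalClosure_eq_top]
    refine (h4.denseRange.dense_image h5 hd).mono ?_
    rintro _ ⟨_, ⟨v, hv, rfl⟩, rfl⟩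
    refine ⟨v, hv, ?_⟩
    ext1 k
    simp
  rw [← famDim_topologicalClosure, h2, famDim_top]
  simp

theorem one_le_famDim {V : Submodule ℂ (L2Fam Γ ι)} (hV : IsClosedInvariant V) (x : ι)
    (hd : Dense {f : L2 Γ | ∃ v ∈ V, v x = f}) : 1 ≤ famDim V :=
  (one_le_famDim_map x hd).trans (hV.famDim_map_le (equivariant_selectOp _))

end IsClosedInvariant

end Dim

end L2Group

namespace L2Group

section Affiliated

variable {Γ : Type*} [Group Γ] {ι κ μ : Type*} [Fintype ι] [Fintype κ] [Fintype μ]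

/-! ### Affiliated operators through their graphs -/

theorem rightTranslation_mem_commutant (g : Γ) :
    rightTranslation g ∈ (groupVN Γ).commutant := by
  rw [VonNeumannAlgebra.mem_commutant_iff]
  exact fun T hT => ((mem_groupVN_iff T).1 hT g).symm

open Classical in
/-- The inclusion of `l²(Γ)` as a member of families. -/
def singleOp (j : ι) : L2 Γ →L[ℂ] L2Fam Γ ι :=
  (PiLp.continuousLinearEquiv 2 ℂ fun _ : ι => L2 Γ).symm.toContinuousLinearMap ∘L
    ContinuousLinearMap.single ℂ (fun _ : ι => L2 Γ) j

theorem singleOp_apply_same (j : ι) (f : L2 Γ) : singleOp j f j = f := by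
  simp [singleOp]

theorem singleOp_apply_of_ne {i j : ι} (h : i ≠ j) (f : L2 Γ) : singleOp j f i = 0 := by
  simp [singleOp, h]

theorem sum_singleOp (v : L2Fam Γ ι) : ∑ j, singleOp j (v j) = v := by
  ext1 i
  rw [WithLp.ofLp_sum, Finset.sum_apply, Finset.sum_eq_single i]
  · exact singleOp_apply_same i _
  · exact fun j _ hj => singleOp_apply_of_ne hj.symm _
  · simp

theorem famTranslation_singleOp (g : Γ) (j : ι) (f : L2 Γ) :
    famTranslation ι g (singleOp j f) = singleOp j (rightTranslation g f) := by
  ext1 i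
  by_cases h : i = j
  · subst h
    simp [singleOp_apply_same]
  · simp [singleOp_apply_of_ne h]

/-- Commuting with right translations puts all matrix entries of `A` in `𝒩Γ`, so they commute with
its whole commutant, as affiliation demands. -/
theorem Equivariant.diagOp_apply {A : L2Fam Γ ι →L[ℂ] L2Fam Γ κ} (hA : Equivariant A)
    {b : L2 Γ →L[ℂ] L2 Γ} (hb : b ∈ (groupVN Γ).commutant) (v : L2Fam Γ ι) :
    A (diagOp b v) = diagOp b (A v) := by
  have hentry : ∀ k j (f : L2 Γ), A (singleOp j (b f)) k = b (A (singleOp j f) k) := by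
    intro k j f
    have hmem : (PiLp.proj 2 (fun _ : κ => L2 Γ) k ∘L A ∘L singleOp j : L2 Γ →L[ℂ] L2 Γ) ∈
        groupVN Γ := by
      rw [mem_groupVN_iff]
      intro g
      ext1 f
      change rightTranslation g (A (singleOp j f) k) = A (singleOp j (rightTranslation g f)) k
      rw [← famTranslation_singleOp, hA, L2Group.diagOp_apply]
    have h := (VonNeumannAlgebra.mem_commutant_iff.1 hb) _ hmem
    exact congrArg (fun T : L2 Γ →L[ℂ] L2 Γ => T f) h
  ext1 k
  rw [L2Group.diagOp_apply, ← sum_singleOp (Γ := Γ) (diagOp b v)]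
  conv_rhs => rw [← sum_singleOp (Γ := Γ) v]
  simp only [map_sum, WithLp.ofLp_sum, Finset.sum_apply, L2Group.diagOp_apply, hentry]

theorem IsClosedInvariant.diagOp_mem {V : Submodule ℂ (L2Fam Γ ι)} (hV : IsClosedInvariant V)
    {b : L2 Γ →L[ℂ] L2 Γ} (hb : b ∈ (groupVN Γ).commutant) {v : L2Fam Γ ι} (hv : v ∈ V) :
    diagOp b v ∈ V := by
  have := hV.hasOrthogonalProjection
  rw [← Submodule.starProjection_eq_self_iff.2 hv, ← hV.equivariant_starProjection.diagOp_apply hb]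
  exact V.starProjection_apply_mem _

/-- The families whose members `i` and `j` form a point of the graph of `T`. -/
def coordGraph (T : L2 Γ →ₗ.[ℂ] L2 Γ) (i j : ι) : Submodule ℂ (L2Fam Γ ι) :=
  T.graph.comap ((PiLp.projₗ 2 (fun _ : ι => L2 Γ) i).prod (PiLp.projₗ 2 (fun _ : ι => L2 Γ) j))

theorem mem_coordGraph {T : L2 Γ →ₗ.[ℂ] L2 Γ} {i j : ι} {v : L2Fam Γ ι} :
    v ∈ coordGraph T i j ↔ (v i, v j) ∈ T.graph := Iff.rfl

/-- Translation invariance of the graph is enough: the projection onto the closed graph is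
equivariant, so it commutes with every operator of the commutant applied diagonally. -/
theorem isAffiliated_of_translate {T : L2 Γ →ₗ.[ℂ] L2 Γ} (hc : T.IsClosed)
    (hd : Dense (T.domain : Set (L2 Γ)))
    (ht : ∀ g x y, (x, y) ∈ T.graph → (rightTranslation g x, rightTranslation g y) ∈ T.graph) :
    IsAffiliated Γ T := by
  refine ⟨hc, hd, fun b hb x => ?_⟩
  have hV : IsClosedInvariant (coordGraph T (0 : Fin 2) 1) :=
    ⟨hc.preimage ((continuous_coord 0).prodMk (continuous_coord 1)),
      fun g v hv => by
        rw [mem_coordGraph] at hv ⊢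
        simpa using ht g _ _ hv⟩
  have h := hV.diagOp_mem hb (v := WithLp.toLp 2 ![(x : L2 Γ), T x]) (T.mem_graph x)
  rw [mem_coordGraph, L2Group.diagOp_apply, L2Group.diagOp_apply] at h
  obtain ⟨y, hy1, hy2⟩ := (LinearPMap.mem_graph_iff _).1 h
  have hy1 : (y : L2 Γ) = b x := hy1
  have hy2 : T y = b (T x) := hy2
  refine ⟨hy1 ▸ y.2, ?_⟩
  rw [← hy2]
  congr 1
  exact Subtype.ext hy1.symm

namespace IsAffiliated

variable {S T : L2 Γ →ₗ.[ℂ] L2 Γ}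

theorem translate_mem (hT : IsAffiliated Γ T) (g : Γ) {x y : L2 Γ} (h : (x, y) ∈ T.graph) :
    (rightTranslation g x, rightTranslation g y) ∈ T.graph := by
  obtain ⟨z, rfl, rfl⟩ := (LinearPMap.mem_graph_iff _).1 h
  obtain ⟨h1, h2⟩ := hT.commutes _ (rightTranslation_mem_commutant g) z
  rw [← h2]
  exact T.mem_graph ⟨_, h1⟩

theorem isClosedInvariant_coordGraph (hT : IsAffiliated Γ T) (i j : ι) :
    IsClosedInvariant (coordGraph T i j) :=
  ⟨hT.isClosed.preimage ((continuous_coord i).prodMk (continuous_coord j)),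
    fun g v hv => by
      rw [mem_coordGraph] at hv ⊢
      simpa using hT.translate_mem g hv⟩

/-- Forgetting coordinate `j` maps this space onto the families whose `i`-th member lies in the
domain of `T`, a dense subspace of the remaining coordinates. -/
theorem le_famDim_coordGraph (hT : IsAffiliated Γ T) {i j : ι} (hij : i ≠ j) :
    (Fintype.card ι : ℝ) - 1 ≤ famDim (coordGraph (ι := ι) T i j) := by
  classical
  have he := equivariant_selectOp (Γ := Γ) (fun k : {k : ι // k ≠ j} => (k : ι))
  refine le_trans ?_ ((hT.isClosedInvariant_coordGraph i j).famDim_map_le he)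
  have hcard : (Fintype.card {k : ι // k ≠ j} : ℝ) = Fintype.card ι - 1 := by
    have h : Fintype.card {k : ι // k ≠ j} + 1 = Fintype.card ι := by
      rw [Fintype.card_subtype_compl, Fintype.card_subtype_eq]
      exact Nat.sub_add_cancel (Fintype.card_pos_iff.2 ⟨j⟩)
    rw [← h]
    push_cast
    ring
  rw [← hcard, ← famDim_top (Γ := Γ), ← famDim_topologicalClosure (Submodule.map _ _)]
  refine le_of_eq (congrArg famDim (Eq.symm ?_))
  rw [← Submodule.dense_iff_topologicalClosure_eq_top]
  -- Preimages of dense sets under open maps are dense.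
  have hopen : IsOpenMap fun w : L2Fam Γ {k : ι // k ≠ j} => w ⟨i, hij⟩ :=
    (PiLp.proj (𝕜 := ℂ) 2 (fun _ : {k : ι // k ≠ j} => L2 Γ) ⟨i, hij⟩).isOpenMap
      fun f => ⟨WithLp.toLp 2 fun _ => f, rfl⟩
  refine (hT.dense_domain.preimage hopen).mono ?_
  intro w hw
  refine ⟨WithLp.toLp 2 fun k => if h : k = j then T ⟨_, hw⟩ else w ⟨k, h⟩, ?_, ?_⟩
  · refine mem_coordGraph.2 ?_
    simpa [hij] using T.mem_graph ⟨_, hw⟩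
  · ext1 k
    simp [k.2]

theorem famDim_iInf_coordGraph {σ : Type*} [Fintype σ] {T : σ → L2 Γ →ₗ.[ℂ] L2 Γ}
    (hT : ∀ s, IsAffiliated Γ (T s)) {p c : σ → ι} (hpc : ∀ s, p s ≠ c s) :
    (Fintype.card ι : ℝ) - Fintype.card σ ≤ famDim (⨅ s, coordGraph (T s) (p s) (c s)) :=
  IsClosedInvariant.famDim_iInf (fun s => (hT s).isClosedInvariant_coordGraph _ _)
    fun s => (hT s).le_famDim_coordGraph (hpc s)

theorem eq_of_coordGraph_zero {v : L2Fam Γ (Fin 2)} (hv : v ∈ coordGraph T 0 1) (h : v 0 = 0) :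
    v = 0 := by
  rw [mem_coordGraph, h] at hv
  ext1 i
  fin_cases i
  · exact h
  · exact T.graph_fst_eq_zero_snd hv rfl

/-- A graph has dimension at most one. The intersection of the two graphs projects densely to the
domain side, so it already has dimension one and exhausts the graph of `S`. -/
theorem le_of_dense (hS : IsAffiliated Γ S) (hT : IsAffiliated Γ T)
    (h : Dense {x | ∃ y, (x, y) ∈ S.graph ∧ (x, y) ∈ T.graph}) : S ≤ T := by
  have h1 := hS.isClosedInvariant_coordGraph (0 : Fin 2) 1
  have h2 := hT.isClosedInvariant_coordGraph (0 : Fin 2) 1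
  have h3 : coordGraph S (0 : Fin 2) 1 ⊓ coordGraph T 0 1 = coordGraph S 0 1 := by
    refine (h1.inf h2).eq_of_le_of_famDim_le h1 inf_le_left ?_
    refine (h1.famDim_le_one 0 fun v hv hv0 => eq_of_coordGraph_zero hv hv0).trans ?_
    refine (h1.inf h2).one_le_famDim 0 (h.mono ?_)
    rintro x ⟨y, hy⟩
    exact ⟨WithLp.toLp 2 ![x, y], hy, rfl⟩
  refine LinearPMap.le_graph_iff.1 ?_
  rintro ⟨x, y⟩ hxy
  have h4 : (WithLp.toLp 2 ![x, y] : L2Fam Γ (Fin 2)) ∈ coordGraph S (0 : Fin 2) 1 := hxy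
  rw [← h3] at h4
  exact h4.2

/-- Affiliated operators that agree on a dense set are equal. -/
theorem eq_of_dense (hS : IsAffiliated Γ S) (hT : IsAffiliated Γ T)
    (h : Dense {x | ∃ y, (x, y) ∈ S.graph ∧ (x, y) ∈ T.graph}) : S = T := by
  refine le_antisymm (hS.le_of_dense hT h) (hT.le_of_dense hS ?_)
  simpa only [and_comm] using h

end IsAffiliated

/-! ### Closures of sums and products -/

theorem continuous_pair : Continuous fun p : L2 Γ × L2 Γ =>
    (WithLp.toLp 2 ![p.1, p.2] : L2Fam Γ (Fin 2)) := by
  refine (PiLp.continuous_toLp 2 _).comp (continuous_pi fun i => ?_)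
  fin_cases i
  · exact continuous_fst
  · exact continuous_snd

/-- An operator whose graph is parametrized by a closed invariant subspace of dimension at least one
is closable, and its closure is affiliated. -/
theorem isAffiliated_closure {T : L2 Γ →ₗ.[ℂ] L2 Γ} {W : Submodule ℂ (L2Fam Γ ι)}
    (hW : IsClosedInvariant W) {f : L2Fam Γ ι →L[ℂ] L2Fam Γ (Fin 2)} (hf : Equivariant f)
    (hgraph : ∀ x y, (x, y) ∈ T.graph ↔ ∃ v ∈ W, x = f v 0 ∧ y = f v 1)
    (hinj : ∀ v ∈ W, f v 0 = 0 → v = 0) (hd : 1 ≤ famDim W) :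
    IsAffiliated Γ T.closure := by
  set G := (W.map f.toLinearMap).topologicalClosure with hG
  have hGc : IsClosedInvariant G := hW.closure_map hf
  have hs := equivariant_selectOp (Γ := Γ) (fun _ : Unit => (0 : Fin 2))
  set s := selectOp (Γ := Γ) (fun _ : Unit => (0 : Fin 2)) with hsdef
  have hsv : ∀ v : L2Fam Γ (Fin 2), s v = 0 ↔ v 0 = 0 := by
    intro v
    constructor
    · intro h
      simpa [hsdef] using congrArg (fun w : L2Fam Γ Unit => w ()) h
    · intro h
      ext1 k
      simp [hsdef, h]
  have hG1 : famDim G = famDim W := by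
    rw [hG, famDim_topologicalClosure, hW.famDim_map_of_injOn hf]
    intro v hv h
    exact hinj v hv (by rw [h]; rfl)
  -- Closability: the closure `G` must not acquire a nonzero vector `(0, y)`. It has the dimension
  -- of `W`, and so does at least the image of its first coordinate, which contains that of `f W`.
  -- Rank–nullity leaves dimension zero for the kernel.
  have hbot : G ⊓ s.ker = ⊥ := by
    refine (hGc.inf (.ker hs)).eq_bot_of_famDim_le ?_
    have h1 := hGc.famDim_eq hs
    have h2 : famDim W ≤ famDim (G.map s.toLinearMap) := by
      rw [← hW.famDim_map_of_injOn (hs.comp hf) fun v hv h => hinj v hv ((hsv _).1 h),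
        ← famDim_topologicalClosure, ← famDim_topologicalClosure (G.map _)]
      refine (hW.closure_map (hs.comp hf)).famDim_mono (hGc.closure_map hs)
        (Submodule.topologicalClosure_mono ?_)
      rintro _ ⟨v, hv, rfl⟩
      exact ⟨f v, Submodule.le_topologicalClosure _ ⟨v, hv, rfl⟩, rfl⟩
    linarith
  have hGinj : ∀ v ∈ G, v 0 = 0 → v = 0 := by
    intro v hv h
    have : v ∈ G ⊓ s.ker := ⟨hv, (hsv v).2 h⟩
    rw [hbot] at this
    exact this
  have hto : ∀ p ∈ T.graph.topologicalClosure,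
      (WithLp.toLp 2 ![p.1, p.2] : L2Fam Γ (Fin 2)) ∈ G := by
    intro p hp
    refine map_mem_closure (f := fun p : L2 Γ × L2 Γ =>
      (WithLp.toLp 2 ![p.1, p.2] : L2Fam Γ (Fin 2))) continuous_pair hp ?_
    rintro ⟨x, y⟩ hxy
    obtain ⟨v, hv, rfl, rfl⟩ := (hgraph x y).1 hxy
    refine ⟨v, hv, ?_⟩
    ext1 i
    fin_cases i <;> rfl
  have hclosable : T.IsClosable := by
    refine ⟨T.graph.topologicalClosure.toLinearPMap, ?_⟩
    rw [Submodule.toLinearPMap_graph_eq]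
    intro p hp hp0
    have h := hGinj _ (hto p hp) hp0
    exact congrArg (fun v : L2Fam Γ (Fin 2) => v 1) h
  have hcg := hclosable.graph_closure_eq_closure_graph
  refine isAffiliated_of_translate hclosable.closure_isClosed ?_ ?_
  · refine (hGc.dense_coord 0 hGinj (by rw [hG1]; exact hd)).mono ?_
    rintro _ ⟨v, hv, rfl⟩
    refine LinearPMap.mem_domain_of_mem_graph (y := v 1) ?_
    rw [← hcg]
    refine map_mem_closure (f := fun v : L2Fam Γ (Fin 2) => (v 0, v 1))
      ((continuous_coord 0).prodMk (continuous_coord 1)) hv ?_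
    rintro _ ⟨w, hw, rfl⟩
    exact (hgraph _ _).2 ⟨w, hw, rfl, rfl⟩
  · intro g x y hxy
    rw [← hcg] at hxy ⊢
    refine map_mem_closure (f := Prod.map (rightTranslation g) (rightTranslation g))
      ((rightTranslation g).continuous.prodMap (rightTranslation g).continuous) hxy ?_
    rintro ⟨x, y⟩ hxy
    obtain ⟨v, hv, rfl, rfl⟩ := (hgraph x y).1 hxy
    refine (hgraph _ _).2 ⟨_, hW.translate_mem g v hv, ?_, ?_⟩
    · rw [hf]; simp
    · rw [hf]; simp

theorem mem_graph_add {S T : L2 Γ →ₗ.[ℂ] L2 Γ} {x y z : L2 Γ} (hS : (x, y) ∈ S.graph)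
    (hT : (x, z) ∈ T.graph) : (x, y + z) ∈ (S + T).graph := by
  obtain ⟨u, hu, rfl⟩ := (LinearPMap.mem_graph_iff _).1 hS
  obtain ⟨w, hw, rfl⟩ := (LinearPMap.mem_graph_iff _).1 hT
  obtain ⟨u, hu'⟩ := u
  obtain ⟨w, hw'⟩ := w
  obtain rfl : u = x := hu
  obtain rfl : w = u := hw
  exact (S + T).mem_graph ⟨w, hu', hw'⟩

theorem mem_graph_compUnbounded {S T : L2 Γ →ₗ.[ℂ] L2 Γ} {x y z : L2 Γ} (hT : (x, y) ∈ T.graph)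
    (hS : (y, z) ∈ S.graph) : (x, z) ∈ (compUnbounded S T).graph := by
  obtain ⟨⟨u, hu'⟩, hu, rfl⟩ := (LinearPMap.mem_graph_iff _).1 hT
  obtain ⟨⟨w, hw'⟩, hw, rfl⟩ := (LinearPMap.mem_graph_iff _).1 hS
  obtain rfl : u = x := hu
  have hw : w = T ⟨u, hu'⟩ := hw
  subst hw
  exact (compUnbounded S T).mem_graph ⟨u, hu', hw'⟩

namespace IsAffiliated

variable {S T : L2 Γ →ₗ.[ℂ] L2 Γ}

/-- The graph of the sum is the image of the triples `(x, Sx, Tx)` under `(x, y, z) ↦ (x, y + z)`.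
Two constraints on three coordinates leave dimension at least one. -/
theorem addOp (hS : IsAffiliated Γ S) (hT : IsAffiliated Γ T) : IsAffiliated Γ (addOp S T) := by
  have h1 := hS.isClosedInvariant_coordGraph (0 : Fin 3) 1
  have h2 := hT.isClosedInvariant_coordGraph (0 : Fin 3) 2
  have hf : Equivariant (entriesOp (Γ := Γ) (![![1, 0, 0], ![0, 1, 1]] : Fin 2 → Fin 3 → _)) := by
    refine equivariant_entriesOp fun k i => ?_
    have h0 : (0 : L2 Γ →L[ℂ] L2 Γ) ∈ groupVN Γ := zero_mem _
    have h1 : (1 : L2 Γ →L[ℂ] L2 Γ) ∈ groupVN Γ := one_mem _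
    fin_cases k <;> fin_cases i <;> assumption
  refine isAffiliated_closure (h1.inf h2) hf (fun x y => ?_) (fun v hv h => ?_) ?_
  · constructor
    · intro h
      obtain ⟨u, rfl, rfl⟩ := (LinearPMap.mem_graph_iff _).1 h
      refine ⟨WithLp.toLp 2 ![u, S ⟨u, u.2.1⟩, T ⟨u, u.2.2⟩],
        ⟨S.mem_graph ⟨u, u.2.1⟩, T.mem_graph ⟨u, u.2.2⟩⟩, ?_, ?_⟩
      · simp [Fin.sum_univ_three]
      · simp [Fin.sum_univ_three]
        rfl
    · rintro ⟨v, ⟨hv1, hv2⟩, rfl, rfl⟩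
      simpa [Fin.sum_univ_three] using mem_graph_add hv1 hv2
  · have h : v 0 = 0 := by simpa [Fin.sum_univ_three] using h
    have h3 : v 1 = 0 := S.graph_fst_eq_zero_snd hv.1 h
    have h4 : v 2 = 0 := T.graph_fst_eq_zero_snd hv.2 h
    ext1 i
    fin_cases i <;> assumption
  · have := h1.famDim_inf h2
    have h3 := hS.le_famDim_coordGraph (show (0 : Fin 3) ≠ 1 by decide)
    have h4 := hT.le_famDim_coordGraph (show (0 : Fin 3) ≠ 2 by decide)
    simp only [Fintype.card_fin] at *
    push_cast at *
    linarith

/-- Same count for the triples `(x, Tx, STx)`, of which the outer coordinates are kept. -/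
theorem mulOp (hS : IsAffiliated Γ S) (hT : IsAffiliated Γ T) : IsAffiliated Γ (mulOp S T) := by
  have h1 := hT.isClosedInvariant_coordGraph (0 : Fin 3) 1
  have h2 := hS.isClosedInvariant_coordGraph (1 : Fin 3) 2
  refine isAffiliated_closure (h1.inf h2) (equivariant_selectOp ![0, 2]) (fun x y => ?_)
    (fun v hv h => ?_) ?_
  · constructor
    · intro h
      obtain ⟨u, rfl, rfl⟩ := (LinearPMap.mem_graph_iff _).1 h
      exact ⟨WithLp.toLp 2 ![u, T ⟨u, u.2.1⟩, S ⟨_, u.2.2⟩],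
        ⟨T.mem_graph ⟨u, u.2.1⟩, S.mem_graph ⟨_, u.2.2⟩⟩, rfl, rfl⟩
    · rintro ⟨v, ⟨hv1, hv2⟩, rfl, rfl⟩
      exact mem_graph_compUnbounded hv1 hv2
  · have h : v 0 = 0 := by simpa using h
    have h3 : v 1 = 0 := T.graph_fst_eq_zero_snd hv.1 h
    have h4 : v 2 = 0 := S.graph_fst_eq_zero_snd hv.2 h3
    ext1 i
    fin_cases i <;> assumption
  · have := h1.famDim_inf h2
    have h3 := hT.le_famDim_coordGraph (show (0 : Fin 3) ≠ 1 by decide)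
    have h4 := hS.le_famDim_coordGraph (show (1 : Fin 3) ≠ 2 by decide)
    simp only [Fintype.card_fin] at *
    push_cast at *
    linarith

theorem neg (hT : IsAffiliated Γ T) : IsAffiliated Γ (-T) where
  isClosed := by
    have h := hT.isClosed.preimage (continuous_fst.prodMk continuous_snd.neg :
      Continuous fun p : L2 Γ × L2 Γ => (p.1, -p.2))
    unfold LinearPMap.IsClosed
    convert! h using 1
    ext ⟨x, y⟩
    simp only [SetLike.mem_coe, LinearPMap.mem_graph_iff, Set.mem_preimage, LinearPMap.neg_apply]
    exact exists_congr fun z => and_congr_right fun _ => neg_eq_iff_eq_neg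
  dense_domain := hT.dense_domain
  commutes b hb x := by
    obtain ⟨h1, h2⟩ := hT.commutes b hb x
    refine ⟨h1, ?_⟩
    change -T _ = b (-T _)
    rw [h2, map_neg]

end IsAffiliated

theorem mem_graph_ofBounded {b : L2 Γ →L[ℂ] L2 Γ} {x y : L2 Γ} :
    (x, y) ∈ (ofBounded b).graph ↔ y = b x := by
  rw [LinearPMap.mem_graph_iff]
  constructor
  · rintro ⟨z, rfl, rfl⟩
    rfl
  · rintro rfl
    exact ⟨⟨x, trivial⟩, rfl, rfl⟩

theorem isAffiliated_ofBounded {b : L2 Γ →L[ℂ] L2 Γ} (hb : b ∈ groupVN Γ) :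
    IsAffiliated Γ (ofBounded b) := by
  refine isAffiliated_of_translate ?_ dense_univ ?_
  · have h : ((ofBounded b).graph : Set (L2 Γ × L2 Γ)) = {p | p.2 = b p.1} := by
      ext ⟨x, y⟩
      exact mem_graph_ofBounded
    unfold LinearPMap.IsClosed
    rw [h]
    exact isClosed_eq continuous_snd (b.continuous.comp continuous_fst)
  · intro g x y h
    rw [mem_graph_ofBounded] at h ⊢
    rw [h]
    exact congrArg (fun T : L2 Γ →L[ℂ] L2 Γ => T x) ((mem_groupVN_iff b).1 hb g)

end Affiliated

end L2Group

namespace L2Group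

/-! ### The ring of affiliated operators -/

/-- The set `𝒰Γ` of affiliated operators. -/
def Affil (Γ : Type*) [Group Γ] : Type _ := {T : L2 Γ →ₗ.[ℂ] L2 Γ // IsAffiliated Γ T}

namespace Affil

variable {Γ : Type*} [Group Γ] {ι κ : Type*} [Fintype ι] [Fintype κ]

/-- `T.Rel x y` says that `x` is in the domain of `T` and `T x = y`. -/
def Rel (T : Affil Γ) (x y : L2 Γ) : Prop := (x, y) ∈ T.1.graph

/-- A bounded operator in `𝒩Γ` as an affiliated operator. -/
def ofVN (b : L2 Γ →L[ℂ] L2 Γ) (hb : b ∈ groupVN Γ) : Affil Γ :=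
  ⟨ofBounded b, isAffiliated_ofBounded hb⟩

instance : Zero (Affil Γ) := ⟨ofVN 0 (zero_mem _)⟩
instance : One (Affil Γ) := ⟨ofVN 1 (one_mem _)⟩
instance : Add (Affil Γ) := ⟨fun S T => ⟨addOp S.1 T.1, S.2.addOp T.2⟩⟩
instance : Mul (Affil Γ) := ⟨fun S T => ⟨mulOp S.1 T.1, S.2.mulOp T.2⟩⟩
instance : Neg (Affil Γ) := ⟨fun T => ⟨-T.1, T.2.neg⟩⟩

namespace Rel

variable {S T : Affil Γ} {x y z w : L2 Γ}

theorem unique (h : T.Rel x y) (h' : T.Rel x z) : y = z :=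
  LinearPMap.mem_graph_snd_inj _ h h' rfl

theorem add_apply (hS : S.Rel x y) (hT : T.Rel x z) : (S + T).Rel x (y + z) :=
  LinearPMap.le_graph_of_le (S.1 + T.1).le_closure (mem_graph_add hS hT)

theorem mul_apply (hT : T.Rel x y) (hS : S.Rel y z) : (S * T).Rel x z :=
  LinearPMap.le_graph_of_le (compUnbounded S.1 T.1).le_closure (mem_graph_compUnbounded hT hS)

theorem neg_apply (hT : T.Rel x y) : (-T).Rel x (-y) := by
  obtain ⟨u, rfl, rfl⟩ := (LinearPMap.mem_graph_iff _).1 hT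
  exact (-T.1).mem_graph u

theorem add (hT : T.Rel x y) (hT' : T.Rel z w) : T.Rel (x + z) (y + w) :=
  T.1.graph.add_mem hT hT'

theorem sum {σ : Type*} {s : Finset σ} {x y : σ → L2 Γ} (h : ∀ i ∈ s, T.Rel (x i) (y i)) :
    T.Rel (∑ i ∈ s, x i) (∑ i ∈ s, y i) := by
  have hs : (∑ i ∈ s, x i, ∑ i ∈ s, y i) = ∑ i ∈ s, (x i, y i) :=
    Prod.ext (Prod.fst_sum (f := fun i => (x i, y i))).symm
      (Prod.snd_sum (f := fun i => (x i, y i))).symm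
  unfold Rel
  rw [hs]
  exact T.1.graph.sum_mem h

theorem eq_zero (hT : T.Rel 0 y) : y = 0 := T.1.graph_fst_eq_zero_snd hT rfl

end Rel

theorem rel_ofVN {b : L2 Γ →L[ℂ] L2 Γ} {hb : b ∈ groupVN Γ} {x y : L2 Γ} :
    (ofVN b hb).Rel x y ↔ y = b x := mem_graph_ofBounded

theorem rel_zero {x y : L2 Γ} : (0 : Affil Γ).Rel x y ↔ y = 0 := rel_ofVN

theorem rel_one {x y : L2 Γ} : (1 : Affil Γ).Rel x y ↔ y = x := rel_ofVN

theorem ext_of_dense {S T : Affil Γ} (h : Dense {x | ∃ y, S.Rel x y ∧ T.Rel x y}) : S = T :=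
  Subtype.ext (S.2.eq_of_dense T.2 h)

/-- Families of vectors satisfying a system of relations in which each member is determined by an
earlier one have dense initial members. -/
theorem dense_tree {n : ℕ} (T : Fin n → Affil Γ) (p : Fin n → Fin (n + 1))
    (hp : ∀ k, p k ≤ k.castSucc) :
    Dense {x | ∃ v : Fin (n + 1) → L2 Γ, v 0 = x ∧ ∀ k, (T k).Rel (v (p k)) (v k.succ)} := by
  set W : Submodule ℂ (L2Fam Γ (Fin (n + 1))) := ⨅ k, coordGraph (T k).1 (p k) k.succ with hW
  have hWc : IsClosedInvariant W :=
    .iInf fun k => (T k).2.isClosedInvariant_coordGraph _ _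
  have hmem : ∀ v, v ∈ W ↔ ∀ k, (T k).Rel (v (p k)) (v k.succ) := fun v => by
    rw [hW, Submodule.mem_iInf]
    rfl
  -- Zero at the root propagates to all members by induction, and `n` relations among `n + 1`
  -- unknowns leave dimension at least one.
  refine (hWc.dense_coord 0 (fun v hv h0 => ?_) ?_).mono ?_
  · rw [hmem] at hv
    have : ∀ m : ℕ, ∀ h : m < n + 1, v ⟨m, h⟩ = 0 := by
      intro m
      induction m using Nat.strong_induction_on with
      | _ m ih =>
        intro h
        rcases m with _ | m
        · exact h0
        · have hk := hv ⟨m, by omega⟩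
          have h1 : v (p ⟨m, by omega⟩) = 0 := by
            have h2 := hp ⟨m, by omega⟩
            exact ih _ (Nat.lt_succ_of_le h2) (p _).2
          rw [h1] at hk
          exact hk.eq_zero
    ext1 i
    exact this i i.2
  · have h := IsAffiliated.famDim_iInf_coordGraph (fun k => (T k).2) (p := p) (c := Fin.succ)
      fun k => ((hp k).trans_lt (Fin.castSucc_lt_succ)).ne
    simp only [Fintype.card_fin] at h
    push_cast at h
    linarith
  · rintro _ ⟨v, hv, rfl⟩
    exact ⟨v, rfl, (hmem v).1 hv⟩

/-! ### Ring axioms, checked on dense sets -/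

theorem dense_domain (T : Affil Γ) : Dense {x | ∃ y, T.Rel x y} :=
  T.2.dense_domain.mono fun x hx => ⟨T.1 ⟨x, hx⟩, T.1.mem_graph ⟨x, hx⟩⟩

theorem ext_of_rel {S T : Affil Γ} (R : Affil Γ)
    (h : ∀ x y, R.Rel x y → ∃ z, S.Rel x z ∧ T.Rel x z) : S = T :=
  ext_of_dense (R.dense_domain.mono fun x hx => hx.elim (h x))

/-- The pattern for the ring axioms: `dense_tree`, fed with operators and the index of the argument
of each, gives a dense set of `x` on which every intermediate vector exists, so the axiom becomes an
identity of vectors. -/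
theorem add_comm' (S T : Affil Γ) : S + T = T + S := by
  refine ext_of_dense ((dense_tree ![S, T] ![0, 0] (by decide)).mono ?_)
  rintro _ ⟨v, rfl, hv⟩
  have h1 : S.Rel (v 0) (v 1) := hv 0
  have h2 : T.Rel (v 0) (v 2) := hv 1
  exact ⟨v 1 + v 2, h1.add_apply h2, by rw [add_comm (v 1)]; exact h2.add_apply h1⟩

theorem add_assoc' (R S T : Affil Γ) : R + S + T = R + (S + T) := by
  refine ext_of_dense ((dense_tree ![R, S, T] ![0, 0, 0] (by decide)).mono ?_)
  rintro _ ⟨v, rfl, hv⟩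
  have h1 : R.Rel _ _ := hv 0
  have h2 : S.Rel _ _ := hv 1
  have h3 : T.Rel _ _ := hv 2
  exact ⟨_, (h1.add_apply h2).add_apply h3, by
    rw [add_assoc]; exact h1.add_apply (h2.add_apply h3)⟩

theorem mul_assoc' (R S T : Affil Γ) : R * S * T = R * (S * T) := by
  refine ext_of_dense ((dense_tree ![T, S, R] ![0, 1, 2] (by decide)).mono ?_)
  rintro _ ⟨v, rfl, hv⟩
  have h1 : T.Rel (v 0) (v 1) := hv 0
  have h2 : S.Rel (v 1) (v 2) := hv 1
  have h3 : R.Rel (v 2) (v 3) := hv 2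
  exact ⟨_, h1.mul_apply (h2.mul_apply h3), (h1.mul_apply h2).mul_apply h3⟩

theorem mul_add' (R S T : Affil Γ) : R * (S + T) = R * S + R * T := by
  refine ext_of_dense ((dense_tree ![S, T, R, R] ![0, 0, 1, 2] (by decide)).mono ?_)
  rintro _ ⟨v, rfl, hv⟩
  have h1 : S.Rel (v 0) (v 1) := hv 0
  have h2 : T.Rel (v 0) (v 2) := hv 1
  have h3 : R.Rel (v 1) (v 3) := hv 2
  have h4 : R.Rel (v 2) (v 4) := hv 3
  exact ⟨_, (h1.add_apply h2).mul_apply (h3.add h4), (h1.mul_apply h3).add_apply (h2.mul_apply h4)⟩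

theorem add_mul' (R S T : Affil Γ) : (R + S) * T = R * T + S * T := by
  refine ext_of_dense ((dense_tree ![T, R, S] ![0, 1, 1] (by decide)).mono ?_)
  rintro _ ⟨v, rfl, hv⟩
  have h1 : T.Rel (v 0) (v 1) := hv 0
  have h2 : R.Rel (v 1) (v 2) := hv 1
  have h3 : S.Rel (v 1) (v 3) := hv 2
  exact ⟨_, h1.mul_apply (h2.add_apply h3), (h1.mul_apply h2).add_apply (h1.mul_apply h3)⟩

instance : Ring (Affil Γ) where
  add_assoc := add_assoc'
  add_comm := add_comm'
  zero_add T := ext_of_rel T fun x y h =>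
    ⟨y, by simpa using (rel_zero.2 rfl).add_apply h, h⟩
  add_zero T := ext_of_rel T fun x y h =>
    ⟨y, by simpa using h.add_apply (rel_zero.2 rfl), h⟩
  neg_add_cancel T := ext_of_rel T fun x y h =>
    ⟨0, by simpa using h.neg_apply.add_apply h, rel_zero.2 rfl⟩
  one_mul T := ext_of_rel T fun x y h =>
    ⟨y, h.mul_apply (rel_one.2 rfl), h⟩
  mul_one T := ext_of_rel T fun x y h =>
    ⟨y, (rel_one.2 rfl).mul_apply h, h⟩
  zero_mul T := ext_of_rel T fun x y h =>
    ⟨0, h.mul_apply (rel_zero.2 rfl), rel_zero.2 rfl⟩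
  mul_zero T := ext_of_rel 0 fun x _ _ =>
    ⟨0, (rel_zero.2 rfl).mul_apply (T.1.graph.zero_mem), rel_zero.2 rfl⟩
  mul_assoc := mul_assoc'
  left_distrib := mul_add'
  right_distrib := add_mul'
  nsmul := nsmulRec
  zsmul := zsmulRec

theorem rel_sum {σ : Type*} {s : Finset σ} {T : σ → Affil Γ} {x : L2 Γ} {y : σ → L2 Γ}
    (h : ∀ i ∈ s, (T i).Rel x (y i)) : (∑ i ∈ s, T i).Rel x (∑ i ∈ s, y i) := by
  classical
  induction s using Finset.induction_on with
  | empty => exact rel_zero.2 rfl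
  | insert a s ha ih =>
    rw [Finset.sum_insert ha, Finset.sum_insert ha]
    exact (h a (Finset.mem_insert_self a s)).add_apply
      (ih fun i hi => h i (Finset.mem_insert_of_mem hi))

instance : Nontrivial (Affil Γ) := by
  classical
  refine ⟨0, 1, fun h => ?_⟩
  have h1 : (0 : Affil Γ).Rel (lp.single 2 (1 : Γ) (1 : ℂ)) (lp.single 2 (1 : Γ) (1 : ℂ)) := by
    rw [h]
    exact rel_one.2 rfl
  have h2 := congrArg (fun f : L2 Γ => f 1) (rel_zero.1 h1)
  simp at h2

/-- The graph has dimension at most one, and a dense range uses up all of it. Hence the kernel of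
the second coordinate has dimension zero. -/
theorem injective_of_dense_range {T : Affil Γ} (h : Dense {y | ∃ x, T.Rel x y}) :
    ∀ x, T.Rel x 0 → x = 0 := by
  have hV := T.2.isClosedInvariant_coordGraph (0 : Fin 2) 1
  have he := equivariant_selectOp (Γ := Γ) (fun _ : Unit => (1 : Fin 2))
  have h1 := hV.famDim_eq he
  have h2 := hV.famDim_le_one 0 fun v hv hv0 => IsAffiliated.eq_of_coordGraph_zero hv hv0
  have h3 := IsClosedInvariant.one_le_famDim_map (V := coordGraph T.1 (0 : Fin 2) 1) 1 (h.mono (by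
    rintro y ⟨x, hxy⟩
    exact ⟨WithLp.toLp 2 ![x, y], hxy, rfl⟩))
  have h4 := (hV.inf (.ker he)).eq_bot_of_famDim_le (by linarith)
  intro x hx
  have h5 : (WithLp.toLp 2 ![x, 0] : L2Fam Γ (Fin 2)) ∈ coordGraph T.1 (0 : Fin 2) 1 ⊓
      (selectOp (Γ := Γ) (fun _ : Unit => (1 : Fin 2))).ker := by
    refine ⟨hx, ?_⟩
    change selectOp _ _ = _
    ext1 k
    simp
  rw [h4] at h5
  exact congrArg (fun v : L2Fam Γ (Fin 2) => v 0) h5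

/-- An injective affiliated operator has dense range, hence is invertible in `𝒰Γ`. -/
theorem exists_inverse {T : Affil Γ} (h : ∀ x, T.Rel x 0 → x = 0) :
    ∃ S : Affil Γ, (∀ x y, S.Rel x y ↔ T.Rel y x) ∧ T * S = 1 ∧ S * T = 1 := by
  have hker : LinearMap.ker T.1.toFun = ⊥ := by
    rw [eq_bot_iff]
    rintro x hx
    have hx : T.1 x = 0 := hx
    have h1 : T.Rel x 0 := hx ▸ T.1.mem_graph x
    exact Subtype.ext (h _ h1)
  have hgraph : ∀ x y, (x, y) ∈ T.1.inverse.graph ↔ (y, x) ∈ T.1.graph := by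
    intro x y
    rw [LinearPMap.inverse_graph hker]
    constructor
    · rintro ⟨⟨a, b⟩, hab, hp⟩
      obtain ⟨rfl, rfl⟩ := Prod.mk.inj hp
      exact hab
    · exact fun hxy => ⟨(y, x), hxy, rfl⟩
  have haff : IsAffiliated Γ T.1.inverse := by
    refine isAffiliated_of_translate ((LinearPMap.inverse_closed_iff hker).2 T.2.isClosed) ?_ ?_
    -- The inverse is densely defined: the second coordinate is injective on a graph of dimension at
    -- least `2 - 1`.
    · have hV := T.2.isClosedInvariant_coordGraph (0 : Fin 2) 1
      refine (hV.dense_coord 1 (fun v hv hv1 => ?_) ?_).mono ?_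
      · rw [mem_coordGraph, hv1] at hv
        have hv0 := h _ hv
        ext1 i
        fin_cases i <;> assumption
      · have := T.2.le_famDim_coordGraph (show (0 : Fin 2) ≠ 1 by decide)
        simp only [Fintype.card_fin] at this
        push_cast at this
        linarith
      · rintro _ ⟨v, hv, rfl⟩
        exact LinearPMap.mem_domain_of_mem_graph ((hgraph _ _).2 hv)
    · intro g x y hxy
      rw [hgraph] at hxy ⊢
      exact T.2.translate_mem g hxy
  refine ⟨⟨T.1.inverse, haff⟩, hgraph, ?_, ?_⟩
  · refine ext_of_rel ⟨T.1.inverse, haff⟩ fun x y hxy => ?_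
    exact ⟨x, hxy.mul_apply ((hgraph _ _).1 hxy), rel_one.2 rfl⟩
  · refine ext_of_rel T fun x y hxy => ?_
    exact ⟨x, hxy.mul_apply (S := ⟨T.1.inverse, haff⟩) ((hgraph _ _).2 hxy), rel_one.2 rfl⟩

/-- A left inverse forces `T` to be injective, so it coincides with the inverse whose graph is the
flipped graph. -/
theorem rel_inverse {T S : Affil Γ} (h : S * T = 1) (x y : L2 Γ) :
    S.Rel x y ↔ T.Rel y x := by
  obtain ⟨S', hS', h3, -⟩ := exists_inverse (T := T) fun x hx => by
    have h' := hx.mul_apply (S := S) S.1.graph.zero_mem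
    rw [h, rel_one] at h'
    exact h'.symm
  obtain rfl : S = S' := left_inv_eq_right_inv h h3
  exact hS' x y

end Affil

end L2Group

namespace L2Group

section GroupRing

variable {Γ : Type*} [Group Γ] {K : Subfield ℂ}

/-! ### The group ring inside the ring of affiliated operators -/

theorem leftTranslation_mem_groupVN (g : Γ) : leftTranslation g ∈ groupVN Γ := by
  rw [mem_groupVN_iff]
  intro h
  ext f x
  change f (g⁻¹ * (x * h⁻¹)) = f (g⁻¹ * x * h⁻¹)
  rw [mul_assoc]

theorem groupRingOp_mem_groupVN (a : MonoidAlgebra K Γ) : groupRingOp a ∈ groupVN Γ := by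
  unfold groupRingOp Finsupp.sum
  exact sum_mem fun g _ => (groupVN Γ).toStarSubalgebra.smul_mem (leftTranslation_mem_groupVN g) _

theorem groupRingOp_zero : groupRingOp (0 : MonoidAlgebra K Γ) = 0 := by
  simp [groupRingOp]

theorem groupRingOp_one : groupRingOp (1 : MonoidAlgebra K Γ) = 1 := by
  ext f x
  simp [groupRingOp, MonoidAlgebra.one_def]

theorem groupRingOp_neg (a : MonoidAlgebra K Γ) : groupRingOp (-a) = -groupRingOp a := by
  simp [groupRingOp, Finsupp.sum]

namespace Affil

/-- Elements of the group ring as affiliated operators. -/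
def ofGroupRing (a : MonoidAlgebra K Γ) : Affil Γ := ofVN _ (groupRingOp_mem_groupVN a)

theorem rel_ofGroupRing {a : MonoidAlgebra K Γ} {x y : L2 Γ} :
    (ofGroupRing a).Rel x y ↔ y = groupRingOp a x := rel_ofVN

theorem ofGroupRing_zero : ofGroupRing (0 : MonoidAlgebra K Γ) = 0 :=
  Subtype.ext (congrArg ofBounded groupRingOp_zero)

theorem ofGroupRing_one : ofGroupRing (1 : MonoidAlgebra K Γ) = 1 :=
  Subtype.ext (congrArg ofBounded groupRingOp_one)

theorem ofGroupRing_neg_one : ofGroupRing (-1 : MonoidAlgebra K Γ) = -1 := by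
  refine ext_of_rel 0 fun x _ _ => ⟨-x, rel_ofGroupRing.2 ?_, (rel_one.2 rfl).neg_apply⟩
  rw [groupRingOp_neg, groupRingOp_one]
  rfl

end Affil

/-! ### The division closure as a subring of affiliated operators -/

theorem InDivisionClosure.isAffiliated {T : L2 Γ →ₗ.[ℂ] L2 Γ} (h : InDivisionClosure Γ K T) :
    IsAffiliated Γ T := by
  induction h with
  | of a => exact isAffiliated_ofBounded (groupRingOp_mem_groupVN a)
  | neg _ h => exact h.neg
  | add _ _ h h' => exact h.addOp h'
  | mul _ _ h h' => exact h.mulOp h'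
  | inv _ h _ => exact h.affiliated

variable (Γ K) in
/-- The division closure as a subring of `𝒰Γ`. -/
def divClosure : Subring (Affil Γ) where
  carrier := {T | InDivisionClosure Γ K T.1}
  mul_mem' h h' := h.mul h'
  add_mem' h h' := h.add h'
  neg_mem' h := h.neg
  one_mem' := by
    rw [← Affil.ofGroupRing_one (K := K)]
    exact .of 1
  zero_mem' := by
    rw [← Affil.ofGroupRing_zero (K := K)]
    exact .of 0

theorem mem_divClosure {T : Affil Γ} : T ∈ divClosure Γ K ↔ InDivisionClosure Γ K T.1 := Iff.rfl

theorem inverse_mem_divClosure {S T : Affil Γ} (hT : T ∈ divClosure Γ K) (h1 : T * S = 1)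
    (h2 : S * T = 1) : S ∈ divClosure Γ K :=
  InDivisionClosure.inv (mem_divClosure.1 hT)
    ⟨S.2, congrArg Subtype.val h1, congrArg Subtype.val h2⟩

variable (Γ K) in
/-- The type `D_KΓ` is the subring `divClosure`. -/
def divisionClosureEquiv : DivisionClosure Γ K ≃ divClosure Γ K where
  toFun T := ⟨⟨T.1, T.2.isAffiliated⟩, T.2⟩
  invFun T := ⟨T.1.1, T.2⟩
  left_inv _ := rfl
  right_inv _ := rfl

theorem isSkewField_iff : IsSkewField (DivisionClosure Γ K) ↔
    ∀ T : divClosure Γ K, T ≠ 0 → IsUnit T := by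
  set e := divisionClosureEquiv Γ K with he
  have hadd : ∀ x y, e (x + y) = e x + e y := fun _ _ => rfl
  have hmul : ∀ x y, e (x * y) = e x * e y := fun _ _ => rfl
  constructor
  · rintro ⟨F, hFadd, hFmul⟩ T hT
    -- `F` is only known to share the two operations, so its zero and one must be identified with
    -- those of the subring.
    have h0 : e F.zero = 0 := by
      have h : F.add F.zero F.zero = F.zero := F.zero_add F.zero
      rw [hFadd] at h
      have h' := hadd F.zero F.zero
      rw [h] at h'
      exact left_eq_add.1 h'
    have h1 : e F.one = 1 := by
      have h : F.mul F.one (e.symm 1) = e.symm 1 := F.one_mul (e.symm 1)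
      rw [hFmul] at h
      have h' := hmul F.one (e.symm 1)
      rw [h, e.apply_symm_apply, mul_one] at h'
      exact h'.symm
    have hT' : e.symm T ≠ F.zero := by
      intro h
      apply hT
      rw [← e.apply_symm_apply T, h, h0]
    have h2 : F.mul (e.symm T) (F.inv (e.symm T)) = F.one := F.mul_inv_cancel _ hT'
    have h3 : F.mul (F.inv (e.symm T)) (e.symm T) = F.one :=
      @inv_mul_cancel₀ _ F.toDivisionSemiring.toGroupWithZero _ hT'
    rw [hFmul] at h2 h3
    refine ⟨⟨T, e (F.inv (e.symm T)), ?_, ?_⟩, rfl⟩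
    · rw [← h1, ← h2, hmul, e.apply_symm_apply]
    · rw [← h1, ← h3, hmul, e.apply_symm_apply]
  · intro h
    let D : DivisionRing (divClosure Γ K) :=
      DivisionRing.ofIsUnitOrEqZero fun T => or_iff_not_imp_right.2 (h T)
    exact ⟨e.divisionRing, fun _ _ => rfl, fun _ _ => rfl⟩

/-! ### Operators defined by linear systems over the group ring -/

/-- `T` is defined by a linear system over `KΓ` with one equation less than unknowns: the unknown
`x` determines a solution, and `T` maps it to the unknown `y`. -/
def Definable (K : Subfield ℂ) (T : Affil Γ) : Prop :=
  ∃ (ι κ : Type) (_ : Fintype ι) (_ : Fintype κ) (M : κ → ι → MonoidAlgebra K Γ) (x y : ι),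
    Fintype.card κ + 1 = Fintype.card ι ∧
      ∀ v : ι → L2 Γ, (∀ k, ∑ i, groupRingOp (M k i) (v i) = 0) →
        T.Rel (v x) (v y) ∧ (v x = 0 → v = 0)

open Classical in
theorem sum_groupRingOp_single {ι : Type*} [Fintype ι] (a : MonoidAlgebra K Γ) (i : ι)
    (v : ι → L2 Γ) :
    ∑ j, groupRingOp ((Pi.single i a : ι → MonoidAlgebra K Γ) j) (v j) = groupRingOp a (v i) := by
  rw [Finset.sum_eq_single i]
  · simp
  · intro j _ hj
    simp [hj, groupRingOp_zero]
  · simp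

theorem definable_ofGroupRing (a : MonoidAlgebra K Γ) : Definable K (Affil.ofGroupRing a) := by
  refine ⟨Fin 2, Unit, inferInstance, inferInstance, fun _ => ![a, -1], 0, 1, rfl, fun v hv => ?_⟩
  have h : v 1 = groupRingOp a (v 0) := by
    have := hv ()
    simp only [Fin.sum_univ_two, Matrix.cons_val_zero, Matrix.cons_val_one, groupRingOp_neg,
      groupRingOp_one] at this
    exact (sub_eq_zero.1 ((sub_eq_add_neg _ _).trans this)).symm
  refine ⟨Affil.rel_ofGroupRing.2 h, fun h0 => ?_⟩
  rw [h0, map_zero] at h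
  ext1 i
  fin_cases i <;> assumption

open Classical in
-- Take the union of both systems and identify the output of `T` with the input of `S`. The two
-- deficits of one equation and the one new equation again give a deficit of one.
theorem Definable.mul {S T : Affil Γ} (hS : Definable K S) (hT : Definable K T) :
    Definable K (S * T) := by
  obtain ⟨ι, κ, _, _, M, x, y, hc, h⟩ := hT
  obtain ⟨ι', κ', _, _, M', x', y', hc', h'⟩ := hS
  refine ⟨ι ⊕ ι', (κ ⊕ κ') ⊕ Unit, inferInstance, inferInstance,
    Sum.elim (Sum.elim (fun k => Sum.elim (M k) 0) fun k => Sum.elim 0 (M' k))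
      (fun _ => Sum.elim (Pi.single y 1) (Pi.single x' (-1))), .inl x, .inr y', ?_, fun v hv => ?_⟩
  · simp only [Fintype.card_sum, Fintype.card_unit]
    omega
  · simp only [Sum.forall, Sum.elim_inl, Sum.elim_inr, Fintype.sum_sum_type, Pi.zero_apply,
      groupRingOp_zero, zero_apply, Finset.sum_const_zero, add_zero,
      zero_add, sum_groupRingOp_single, groupRingOp_neg, groupRingOp_one] at hv
    obtain ⟨⟨h1, h2⟩, h3⟩ := hv
    have h3 : v (.inl y) = v (.inr x') :=
      sub_eq_zero.1 ((sub_eq_add_neg _ _).trans (h3 ()))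
    obtain ⟨r, z⟩ := h (fun i => v (.inl i)) h1
    obtain ⟨r', z'⟩ := h' (fun i => v (.inr i)) h2
    rw [← h3] at r'
    refine ⟨r.mul_apply r', fun h0 => ?_⟩
    have e1 := z h0
    have e2 := z' (by rw [← h3]; exact congrFun e1 y)
    ext1 i
    rcases i with i | i
    · exact congrFun e1 i
    · exact congrFun e2 i

open Classical in
-- Take the union of both systems, identify the inputs, and add one unknown with the equation making
-- it the sum of the outputs: two more equations, one more unknown.
theorem Definable.add {S T : Affil Γ} (hS : Definable K S) (hT : Definable K T) :
    Definable K (S + T) := by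
  obtain ⟨ι, κ, _, _, M, x, y, hc, h⟩ := hS
  obtain ⟨ι', κ', _, _, M', x', y', hc', h'⟩ := hT
  refine ⟨(ι ⊕ ι') ⊕ Unit, (κ ⊕ κ') ⊕ Fin 2, inferInstance, inferInstance,
    Sum.elim (Sum.elim (fun k => Sum.elim (Sum.elim (M k) 0) 0)
        fun k => Sum.elim (Sum.elim 0 (M' k)) 0)
      ![Sum.elim (Sum.elim (Pi.single x 1) (Pi.single x' (-1))) 0,
        Sum.elim (Sum.elim (Pi.single y 1) (Pi.single y' 1)) fun _ => -1],
    .inl (.inl x), .inr (), ?_, fun v hv => ?_⟩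
  · simp only [Fintype.card_sum, Fintype.card_unit, Fintype.card_fin]
    omega
  · simp only [Sum.forall, Fin.forall_fin_two, Sum.elim_inl, Sum.elim_inr, Fintype.sum_sum_type,
      Pi.zero_apply, Matrix.cons_val_zero, Matrix.cons_val_one,
      groupRingOp_zero, zero_apply, Finset.sum_const_zero, add_zero,
      zero_add, sum_groupRingOp_single, groupRingOp_neg, groupRingOp_one,
      Finset.univ_unique, Finset.sum_singleton] at hv
    obtain ⟨⟨h1, h2⟩, h3, h4⟩ := hv
    have h3 : v (.inl (.inl x)) = v (.inl (.inr x')) :=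
      sub_eq_zero.1 ((sub_eq_add_neg _ _).trans h3)
    have h4 : v (.inl (.inl y)) + v (.inl (.inr y')) = v (.inr ()) :=
      sub_eq_zero.1 ((sub_eq_add_neg _ _).trans h4)
    obtain ⟨r, z⟩ := h (fun i => v (.inl (.inl i))) h1
    obtain ⟨r', z'⟩ := h' (fun i => v (.inl (.inr i))) h2
    rw [← h3] at r'
    rw [← h4]
    refine ⟨r.add_apply r', fun h0 => ?_⟩
    have e1 := z h0
    have e2 := z' (by rw [← h3]; exact h0)
    ext1 i
    rcases i with (i | i) | i
    · exact congrFun e1 i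
    · exact congrFun e2 i
    · rw [← h4, show v (.inl (.inl y)) = 0 from congrFun e1 y,
        show v (.inl (.inr y')) = 0 from congrFun e2 y', add_zero]
      rfl

/-- The same system with input and output exchanged: a zero output forces a zero input by
injectivity, hence the zero solution. -/
theorem Definable.inverse {S T : Affil Γ} (hT : Definable K T) (h' : S * T = 1) :
    Definable K S := by
  obtain ⟨ι, κ, _, _, M, x, y, hc, h⟩ := hT
  refine ⟨ι, κ, _, _, M, y, x, hc, fun v hv => ?_⟩
  obtain ⟨r, z⟩ := h v hv
  have r' : S.Rel (v y) (v x) := (Affil.rel_inverse h' _ _).2 r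
  refine ⟨r', fun h0 => z ?_⟩
  rw [h0] at r'
  exact r'.eq_zero

theorem InDivisionClosure.definable {T : L2 Γ →ₗ.[ℂ] L2 Γ} (h : InDivisionClosure Γ K T) :
    ∀ T' : Affil Γ, T'.1 = T → Definable K T' := by
  induction h with
  | of a =>
    intro T' hT'
    rw [show T' = Affil.ofGroupRing a from Subtype.ext hT']
    exact definable_ofGroupRing a
  | @neg T h ih =>
    intro T' hT'
    obtain ⟨U, hU⟩ : ∃ U : Affil Γ, U.1 = T := ⟨⟨T, h.isAffiliated⟩, rfl⟩
    -- Negation is multiplication by the group ring element `-1`.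
    have h1 := (definable_ofGroupRing (-1 : MonoidAlgebra K Γ)).mul (ih U hU)
    rw [Affil.ofGroupRing_neg_one, neg_one_mul] at h1
    rwa [show T' = -U from Subtype.ext (hT'.trans (congrArg Neg.neg hU.symm))]
  | @add S T h h' ih ih' =>
    intro T' hT'
    obtain ⟨U, hU⟩ : ∃ U : Affil Γ, U.1 = S := ⟨⟨S, h.isAffiliated⟩, rfl⟩
    obtain ⟨V, hV⟩ : ∃ V : Affil Γ, V.1 = T := ⟨⟨T, h'.isAffiliated⟩, rfl⟩
    rw [show T' = U + V from Subtype.ext (hT'.trans (congrArg₂ addOp hU.symm hV.symm))]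
    exact (ih U hU).add (ih' V hV)
  | @mul S T h h' ih ih' =>
    intro T' hT'
    obtain ⟨U, hU⟩ : ∃ U : Affil Γ, U.1 = S := ⟨⟨S, h.isAffiliated⟩, rfl⟩
    obtain ⟨V, hV⟩ : ∃ V : Affil Γ, V.1 = T := ⟨⟨T, h'.isAffiliated⟩, rfl⟩
    rw [show T' = U * V from Subtype.ext (hT'.trans (congrArg₂ mulOp hU.symm hV.symm))]
    exact (ih U hU).mul (ih' V hV)
  | @inv T S h hi ih =>
    intro T' hT'
    obtain ⟨U, hU⟩ : ∃ U : Affil Γ, U.1 = T := ⟨⟨T, h.isAffiliated⟩, rfl⟩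
    refine (ih U hU).inverse (Subtype.ext ?_)
    have h1 : mulOp T'.1 U.1 = ofBounded 1 := by
      rw [hT', hU]
      exact hi.mul_left
    exact h1

theorem definable_of_mem_divClosure {T : Affil Γ} (hT : T ∈ divClosure Γ K) : Definable K T :=
  (mem_divClosure.1 hT).definable T rfl

end GroupRing

end L2Group

namespace L2Group

section Atiyah

variable {Γ : Type*} [Group Γ] {K : Subfield ℂ}

/-! ### Consequences of the Atiyah conjecture -/

theorem finInv_eq_zmultiples (hΓ : ∀ g : Γ, g ≠ 1 → ¬ IsOfFinOrder g) :
    finInv Γ = AddSubgroup.zmultiples 1 := by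
  have h : {r : ℝ | ∃ F : Subgroup Γ, Finite F ∧ r = 1 / (Nat.card F : ℝ)} = {1} := by
    ext r
    constructor
    · rintro ⟨F, hF, rfl⟩
      have hbot : F = ⊥ := by
        rw [Subgroup.eq_bot_iff_forall]
        intro g hg
        by_contra hne
        exact hΓ g hne (F.subtype.isOfFinOrder (isOfFinOrder_of_finite (⟨g, hg⟩ : F)))
      subst hbot
      simp
    · rintro rfl
      exact ⟨⊥, inferInstance, by simp⟩
  rw [finInv, h, AddSubgroup.zmultiples_eq_closure]

theorem gammaDim_eq_famDim {d : ℕ} (V : Submodule ℂ (L2Pow Γ d)) [V.HasOrthogonalProjection]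
    (hV : IsClosed (V : Set (L2Pow Γ d))) : gammaDim V = famDim (Γ := Γ) (ι := Fin d) V := by
  have h : V.topologicalClosure = V := hV.submodule_topologicalClosure_eq
  have hvec : ∀ i : Fin d, stdVec Γ i = baseVec Γ i := by
    intro i
    unfold stdVec baseVec
    congr!
  simp only [gammaDim, famDim, h, hvec]
  refine Finset.sum_congr rfl fun i _ => ?_
  rw [← inner_conj_symm, Complex.conj_re, inner_starProjection_self, Complex.ofReal_re]

theorem algebraicAtiyah_iff (hΓ : ∀ g : Γ, g ≠ 1 → ¬ IsOfFinOrder g) :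
    AlgebraicAtiyah Γ K ↔ ∀ (d : ℕ) (A : Matrix (Fin d) (Fin d) (MonoidAlgebra K Γ)),
      ∃ n : ℤ, famDim (entriesOp fun i j => groupRingOp (A i j)).ker = n := by
  have hdisc : DiscreteTopology (finInv Γ) := by
    rw [finInv_eq_zmultiples hΓ]
    infer_instance
  have hmem : ∀ r : ℝ, r ∈ finInv Γ ↔ ∃ n : ℤ, r = n := by
    intro r
    rw [finInv_eq_zmultiples hΓ, AddSubgroup.mem_zmultiples_iff]
    simp [eq_comm]
  have hdim : ∀ {d : ℕ} (A : Matrix (Fin d) (Fin d) (MonoidAlgebra K Γ)),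
      gammaDim (LinearMap.ker (matrixOp A).toLinearMap) =
        famDim (entriesOp fun i j => groupRingOp (A i j)).ker :=
    fun A => gammaDim_eq_famDim _ (isClosed_ker_clm (matrixOp A))
  constructor
  · intro h d A
    rw [← hdim]
    exact (hmem _).1 (h hdisc d A)
  · intro h _ d A
    rw [hmem, hdim]
    exact h d A

/-- Transfers integrality to square systems with arbitrary finite index types: relabelling unknowns
and equations preserves the dimension. -/
theorem exists_int_famDim_ker (hΓ : ∀ g : Γ, g ≠ 1 → ¬ IsOfFinOrder g)
    (hA : AlgebraicAtiyah Γ K) {ι κ : Type} [Fintype ι] [Fintype κ]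
    (hcard : Fintype.card κ = Fintype.card ι) (M : κ → ι → MonoidAlgebra K Γ) :
    ∃ n : ℤ, famDim (entriesOp fun k i => groupRingOp (M k i)).ker = n := by
  obtain ⟨e⟩ : Nonempty (Fin (Fintype.card ι) ≃ ι) := ⟨(Fintype.equivFin ι).symm⟩
  obtain ⟨e'⟩ : Nonempty (Fin (Fintype.card ι) ≃ κ) := ⟨hcard ▸ (Fintype.equivFin κ).symm⟩
  obtain ⟨n, hn⟩ := (algebraicAtiyah_iff hΓ).1 hA _ fun i j => M (e' i) (e j)
  refine ⟨n, ?_⟩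
  have he : Equivariant (entriesOp fun k i => groupRingOp (M k i)) :=
    equivariant_entriesOp fun k i => groupRingOp_mem_groupVN (M k i)
  rw [← hn, ← (IsClosedInvariant.ker he).famDim_map_of_injOn (equivariant_selectOp e)]
  · congr 1
    ext w
    constructor
    · rintro ⟨v, hv, rfl⟩
      change entriesOp _ _ = _
      ext1 i
      have h := congrArg (fun u : L2Fam Γ κ => u (e' i)) (show entriesOp _ v = 0 from hv)
      simp only [entriesOp_apply] at h
      change entriesOp _ (selectOp e v) i = 0
      simp only [entriesOp_apply, selectOp_apply]
      rw [← e.sum_comp] at h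
      exact h
    · intro hw
      refine ⟨selectOp e.symm w, ?_, ?_⟩
      · change entriesOp _ _ = _
        ext1 k
        have h := congrArg (fun u : L2Fam Γ (Fin _) => u (e'.symm k))
          (show entriesOp _ w = 0 from hw)
        simp only [entriesOp_apply, Equiv.apply_symm_apply] at h
        simp only [entriesOp_apply, selectOp_apply]
        rw [← e.sum_comp]
        simpa using h
      · ext1 i
        simp
  · intro v _ h
    ext1 i
    simpa using congrArg (fun u : L2Fam Γ (Fin _) => u (e.symm i)) h

/-- The solution space `V` has dimension at least one. Integrality rules out intermediate behaviour
of its subspace `V'` of solutions with zero output: it is either large enough to make `T` zero or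
trivial. -/
theorem isUnit_of_definable (hΓ : ∀ g : Γ, g ≠ 1 → ¬ IsOfFinOrder g)
    (hA : AlgebraicAtiyah Γ K) {T : Affil Γ} (hT : Definable K T) (h0 : T ≠ 0) :
    ∃ S : Affil Γ, T * S = 1 ∧ S * T = 1 := by
  classical
  obtain ⟨ι, κ, _, _, M, x, y, hc, h⟩ := hT
  have hmem : ∀ {κ : Type} [Fintype κ] (M : κ → ι → MonoidAlgebra K Γ) (v : L2Fam Γ ι),
      v ∈ (entriesOp fun k i => groupRingOp (M k i)).ker ↔
        ∀ k, ∑ i, groupRingOp (M k i) (v i) = 0 := by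
    intro κ _ M v
    constructor
    · intro hv k
      simpa using congrArg (fun u : L2Fam Γ κ => u k) (show entriesOp _ v = 0 from hv)
    · intro hv
      change entriesOp _ v = 0
      ext1 k
      simpa using hv k
  have hequiv : ∀ {κ : Type} [Fintype κ] (M : κ → ι → MonoidAlgebra K Γ),
      Equivariant (entriesOp fun k i => groupRingOp (M k i)) := fun M =>
    equivariant_entriesOp fun k i => groupRingOp_mem_groupVN (M k i)
  set V := (entriesOp fun k i => groupRingOp (M k i)).ker with hV
  have hVc : IsClosedInvariant V := .ker (hequiv M)
  have hVd : 1 ≤ famDim V := by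
    have := le_famDim_ker (hequiv M)
    rw [← hc] at this
    push_cast at this
    linarith
  have hVv : ∀ v ∈ V, T.Rel (v x) (v y) ∧ (v x = 0 → v = 0) := by
    intro v hv
    obtain ⟨h1, h2⟩ := h v ((hmem M v).1 hv)
    exact ⟨h1, fun h3 => WithLp.ofLp_injective 2 (h2 h3)⟩
  -- The extra equation `v y = 0` makes the system square, so the conjecture applies.
  let M' : κ ⊕ Unit → ι → MonoidAlgebra K Γ := Sum.elim M fun _ => Pi.single y 1
  obtain ⟨n, hn⟩ := exists_int_famDim_ker hΓ hA (by simpa using hc) M'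
  set V' := (entriesOp fun k i => groupRingOp (M' k i)).ker with hV'
  have hV'c : IsClosedInvariant V' := .ker (hequiv M')
  have hV'v : ∀ v, v ∈ V' ↔ v ∈ V ∧ v y = 0 := by
    intro v
    rw [hmem, hmem, Sum.forall]
    refine and_congr Iff.rfl ?_
    simp only [M', Sum.elim_inr, sum_groupRingOp_single, groupRingOp_one]
    exact ⟨fun h => h (), fun h _ => h⟩
  have hV'i : ∀ v ∈ V', v x = 0 → v = 0 := fun v hv => (hVv v ((hV'v v).1 hv).1).2
  -- Otherwise the inputs of `V'` would be dense, and `T` sends each of them to zero.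
  have hn1 : n < 1 := by
    by_contra hge
    have hd : 1 ≤ famDim V' := by
      rw [hn]
      exact_mod_cast not_lt.1 hge
    refine h0 (Affil.ext_of_dense ((hV'c.dense_coord x hV'i hd).mono ?_))
    rintro _ ⟨v, hv, rfl⟩
    obtain ⟨hv1, hv2⟩ := (hV'v v).1 hv
    refine ⟨0, ?_, Affil.rel_zero.2 rfl⟩
    rw [← hv2]
    exact (hVv v hv1).1
  have hbot : V' = ⊥ := hV'c.eq_bot_of_famDim_le (by
    rw [hn]
    exact_mod_cast (Int.lt_add_one_iff.1 hn1))
  -- With `V' = ⊥` the output coordinate is injective on `V`, so it has dense image.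
  have hdense : Dense {f | ∃ g, T.Rel g f} := by
    refine (hVc.dense_coord y (fun v hv hvy => ?_) hVd).mono ?_
    · have : v ∈ V' := (hV'v v).2 ⟨hv, hvy⟩
      rw [hbot] at this
      exact this
    · rintro _ ⟨v, hv, rfl⟩
      exact ⟨v x, (hVv v hv).1⟩
  obtain ⟨S, -, hS⟩ := Affil.exists_inverse (Affil.injective_of_dense_range hdense)
  exact ⟨S, hS⟩

theorem isUnit_divClosure (hΓ : ∀ g : Γ, g ≠ 1 → ¬ IsOfFinOrder g)
    (hA : AlgebraicAtiyah Γ K) (T : divClosure Γ K) (hT : T ≠ 0) : IsUnit T := by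
  obtain ⟨S, h1, h2⟩ := isUnit_of_definable hΓ hA (definable_of_mem_divClosure T.2)
    fun h => hT (Subtype.ext h)
  exact ⟨⟨T, ⟨S, inverse_mem_divClosure T.2 h1 h2⟩, Subtype.ext h1, Subtype.ext h2⟩, rfl⟩

end Atiyah

end L2Group

/-- Rank factorization of a matrix over a division ring. -/
theorem Matrix.exists_rank_factorization {D : Type*} [DivisionRing D] {m n : Type*} [Fintype m]
    [Fintype n] [DecidableEq m] [DecidableEq n] (A : Matrix m n D) :
    ∃ (r : ℕ) (B : Matrix m (Fin r) D) (C : Matrix (Fin r) n D) (P : Matrix (Fin r) m D)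
      (Q : Matrix n (Fin r) D), A = B * C ∧ P * B = 1 ∧ C * Q = 1 := by
  -- Matrices act on row vectors, so the maps are left linear over the noncommutative `D` and a
  -- composite `q ∘ p` has matrix (matrix of `p`) times (matrix of `q`).
  set f := A.toLinearMapRight' with hf
  let e : LinearMap.range f ≃ₗ[D] (Fin (Module.finrank D (LinearMap.range f)) → D) :=
    (Module.finBasis D (LinearMap.range f)).equivFun
  let p := e.toLinearMap ∘ₗ f.rangeRestrict
  let q := (LinearMap.range f).subtype ∘ₗ e.symm.toLinearMap
  have hpq : q ∘ₗ p = f := LinearMap.ext fun v => by simp [p, q]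
  obtain ⟨s, hs⟩ := p.exists_rightInverse_of_surjective (LinearMap.range_eq_top.2
    (e.surjective.comp f.surjective_rangeRestrict))
  obtain ⟨t, ht⟩ := q.exists_leftInverse_of_injective (LinearMap.ker_eq_bot.2
    ((Submodule.injective_subtype _).comp e.symm.injective))
  refine ⟨_, LinearMap.toMatrixRight' p, LinearMap.toMatrixRight' q, LinearMap.toMatrixRight' s,
    LinearMap.toMatrixRight' t, ?_, ?_, ?_⟩
  · rw [← LinearMap.toMatrixRight'_comp, hpq, hf]
    exact (LinearMap.toMatrixRight'.apply_symm_apply A).symm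
  · rw [← LinearMap.toMatrixRight'_comp, hs, LinearMap.toMatrixRight'_id]
  · rw [← LinearMap.toMatrixRight'_comp, ht, LinearMap.toMatrixRight'_id]

namespace L2Group

section Factorization

variable {Γ : Type*} [Group Γ] {K : Subfield ℂ} {I J L : Type*} [Fintype I] [Fintype J] [Fintype L]

/-! ### Dimensions of kernels and factorizations over the ring of affiliated operators -/

variable (I J L) in
/-- Unknowns `v_j`, `u_lj` and `t_ilj` for the evaluation of a product of two matrices. -/
abbrev FactorVars : Type _ := (J ⊕ L × J) ⊕ I × L × J

variable (I J L) in
/-- Equations for the evaluation of two matrices at `v_l`, followed by a third matrix. -/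
abbrev SolveEqs : Type _ := (J × L ⊕ I × L) ⊕ L × I × L

theorem mem_iInf_coordGraph {ι σ : Type*} {T : σ → Affil Γ} {p c : σ → ι} {v : L2Fam Γ ι} :
    (v ∈ ⨅ s, coordGraph (T s).1 (p s) (c s)) ↔ ∀ s, (T s).Rel (v (p s)) (v (c s)) := by
  rw [Submodule.mem_iInf]
  rfl

/-- Solutions of `Cv = 0` lie in `ker A`, and `C` has `|L|` rows. As the entries are unbounded, the
values `u_lj = C_lj v_j` and `t_ilj = B_il u_lj` become unknowns, each paid for by its own graph
constraint. Only the `|L|` equations `∑ j, u_lj = 0` then lower the dimension. -/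
theorem le_famDim_ker_of_factorization (A : I → J → MonoidAlgebra K Γ)
    (B : Matrix I L (Affil Γ)) (C : Matrix L J (Affil Γ))
    (h : ∀ i j, Affil.ofGroupRing (A i j) = ∑ l, B i l * C l j) :
    (Fintype.card J : ℝ) - Fintype.card L ≤
      famDim (entriesOp fun i j => groupRingOp (A i j)).ker := by
  classical
  let T : (L × J) ⊕ I × L × J → Affil Γ :=
    Sum.elim (fun s => C s.1 s.2) fun s => B s.1 s.2.1
  let p : (L × J) ⊕ I × L × J → FactorVars I J L :=
    Sum.elim (fun s => .inl (.inl s.2)) fun s => .inl (.inr s.2)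
  let c : (L × J) ⊕ I × L × J → FactorVars I J L := Sum.elim (fun s => .inl (.inr s)) .inr
  have hpc : ∀ s, p s ≠ c s := by
    rintro (s | s) <;> simp [p, c]
  let W₁ : Submodule ℂ (L2Fam Γ (FactorVars I J L)) := ⨅ s, coordGraph (T s).1 (p s) (c s)
  have hW₁ : IsClosedInvariant W₁ := .iInf fun s => (T s).2.isClosedInvariant_coordGraph _ _
  have hd₁ : (Fintype.card (FactorVars I J L) : ℝ) - Fintype.card ((L × J) ⊕ I × L × J) ≤
      famDim W₁ :=
    IsAffiliated.famDim_iInf_coordGraph (fun s => (T s).2) hpc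
  let a : L → FactorVars I J L → L2 Γ →L[ℂ] L2 Γ := fun l =>
    Sum.elim (Sum.elim (fun _ => 0) fun s => if s.1 = l then 1 else 0) fun _ => 0
  have ha : Equivariant (entriesOp a) := by
    refine equivariant_entriesOp ?_
    rintro l ((j | s) | s)
    · exact zero_mem (groupVN Γ)
    · simp only [a, Sum.elim_inl, Sum.elim_inr]
      split_ifs
      · exact one_mem (groupVN Γ)
      · exact zero_mem (groupVN Γ)
    · exact zero_mem (groupVN Γ)
  have hW₂ : IsClosedInvariant (entriesOp a).ker := .ker ha
  have hd₂ := le_famDim_ker ha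
  have hd := hW₁.famDim_inf hW₂
  set W := W₁ ⊓ (entriesOp a).ker with hW
  have hWc : IsClosedInvariant W := hW₁.inf hW₂
  have hmem : ∀ v ∈ W, (∀ l j, (C l j).Rel (v (.inl (.inl j))) (v (.inl (.inr (l, j))))) ∧
      (∀ i l j, (B i l).Rel (v (.inl (.inr (l, j)))) (v (.inr (i, l, j)))) ∧
      ∀ l, ∑ j, v (.inl (.inr (l, j))) = 0 := by
    rintro v ⟨h1, h2⟩
    have h1 := mem_iInf_coordGraph.1 h1
    refine ⟨fun l j => h1 (.inl (l, j)), fun i l j => h1 (.inr (i, l, j)), fun l => ?_⟩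
    have h3 := congrArg (fun u : L2Fam Γ L => u l) (show entriesOp a v = 0 from h2)
    simp only [entriesOp_apply, a, Fintype.sum_sum_type, Sum.elim_inl, Sum.elim_inr,
      zero_apply, Finset.sum_const_zero, zero_add, add_zero] at h3
    rw [Fintype.sum_prod_type, Finset.sum_eq_single l] at h3
    · simpa using h3
    · intro l' _ hl'
      simp [hl']
    · simp
  have he := equivariant_selectOp (Γ := Γ) (fun j : J => (.inl (.inl j) : FactorVars I J L))
  set s := selectOp (Γ := Γ) (fun j : J => (.inl (.inl j) : FactorVars I J L)) with hs
  have hmap : famDim (W.map s.toLinearMap) = famDim W := by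
    refine hWc.famDim_map_of_injOn he fun v hv h0 => ?_
    obtain ⟨h1, h2, -⟩ := hmem v hv
    have hJ : ∀ j, v (.inl (.inl j)) = 0 := fun j => by
      simpa [hs] using congrArg (fun u : L2Fam Γ J => u j) h0
    have hLJ : ∀ l j, v (.inl (.inr (l, j))) = 0 := fun l j => by
      have := h1 l j
      rw [hJ] at this
      exact this.eq_zero
    ext1 i
    rcases i with (j | ⟨l, j⟩) | ⟨i, l, j⟩
    · exact hJ j
    · exact hLJ l j
    · have := h2 i l j
      rw [hLJ] at this
      exact this.eq_zero
  have hker : IsClosedInvariant (entriesOp fun i j => groupRingOp (A i j)).ker :=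
    .ker (equivariant_entriesOp fun i j => groupRingOp_mem_groupVN (A i j))
  have hle : W.map s.toLinearMap ≤
      (entriesOp fun i j => groupRingOp (A i j)).ker := by
    rintro _ ⟨v, hv, rfl⟩
    obtain ⟨h1, h2, h3⟩ := hmem v hv
    change entriesOp _ (s v) = 0
    ext1 i
    -- `(Av)_i` is the sum of all `t_ilj`. Summed over `j` first, it is a sum of values of `B_il` at
    -- `∑ j, u_lj = 0`.
    have h4 : ∀ j, groupRingOp (A i j) (v (.inl (.inl j))) = ∑ l, v (.inr (i, l, j)) := by
      intro j
      have h5 := Affil.rel_sum (s := Finset.univ) fun l _ => (h1 l j).mul_apply (h2 i l j)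
      rw [← h] at h5
      exact (Affil.rel_ofGroupRing.1 h5).symm
    have h6 : ∀ l, ∑ j, v (.inr (i, l, j)) = 0 := by
      intro l
      have h5 := Affil.Rel.sum (s := Finset.univ) fun j _ => h2 i l j
      rw [h3] at h5
      exact h5.eq_zero
    simp only [entriesOp_apply, hs, selectOp_apply, h4]
    rw [Finset.sum_comm, Finset.sum_eq_zero fun l _ => h6 l]
    rfl
  have hfin := (hWc.closure_map he).famDim_mono hker
    (Submodule.topologicalClosure_minimal _ hle hker.isClosed)
  rw [famDim_topologicalClosure, hmap] at hfin
  have hcard : (Fintype.card (FactorVars I J L) : ℝ) =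
      Fintype.card J + Fintype.card ((L × J) ⊕ I × L × J) := by
    simp only [Fintype.card_sum]
    push_cast
    ring
  linarith

/-- The range of `A` has dimension at least `|L|`: the families `w` for which `Qw`, `Bw` and `PBw`
are defined entrywise are mapped by `w ↦ AQw = Bw`, injectively because `PB = 1`. Rank–nullity then
bounds the kernel. -/
theorem famDim_ker_le_of_factorization [DecidableEq L] (A : I → J → MonoidAlgebra K Γ)
    (B : Matrix I L (Affil Γ)) (P : Matrix L I (Affil Γ)) (Q : Matrix J L (Affil Γ))
    (hAQ : ∀ i l, ∑ j, Affil.ofGroupRing (A i j) * Q j l = B i l) (hPB : P * B = 1) :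
    famDim (entriesOp fun i j => groupRingOp (A i j)).ker ≤
      (Fintype.card J : ℝ) - Fintype.card L := by
  classical
  let T : SolveEqs I J L → Affil Γ :=
    Sum.elim (Sum.elim (fun s => Q s.1 s.2) fun s => B s.1 s.2) fun s => P s.1 s.2.1
  let p : SolveEqs I J L → (L ⊕ SolveEqs I J L) :=
    Sum.elim (Sum.elim (fun s => .inl s.2) fun s => .inl s.2) fun s => .inr (.inl (.inr s.2))
  have hpc : ∀ s, p s ≠ .inr s := by
    rintro ((s | s) | s) <;> simp [p]
  let X : Submodule ℂ (L2Fam Γ (L ⊕ SolveEqs I J L)) := ⨅ s, coordGraph (T s).1 (p s) (.inr s)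
  have hX : IsClosedInvariant X := .iInf fun s => (T s).2.isClosedInvariant_coordGraph _ _
  have hd : (Fintype.card (L ⊕ SolveEqs I J L) : ℝ) - Fintype.card (SolveEqs I J L) ≤ famDim X :=
    IsAffiliated.famDim_iInf_coordGraph (fun s => (T s).2) hpc
  have hcard : (Fintype.card (L ⊕ SolveEqs I J L) : ℝ) =
      Fintype.card L + Fintype.card (SolveEqs I J L) := by
    simp only [Fintype.card_sum]
    push_cast
    ring
  let a : J → (L ⊕ SolveEqs I J L) → L2 Γ →L[ℂ] L2 Γ := fun j =>
    Sum.elim (fun _ => 0) (Sum.elim (Sum.elim (fun s => if s.1 = j then 1 else 0) fun _ => 0)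
      fun _ => 0)
  have ha : Equivariant (entriesOp a) := by
    refine equivariant_entriesOp ?_
    rintro l (j | ((s | s) | s))
    · exact zero_mem (groupVN Γ)
    · simp only [a, Sum.elim_inl, Sum.elim_inr]
      split_ifs
      · exact one_mem (groupVN Γ)
      · exact zero_mem (groupVN Γ)
    · exact zero_mem (groupVN Γ)
    · exact zero_mem (groupVN Γ)
  have hav : ∀ (v : L2Fam Γ (L ⊕ SolveEqs I J L)) j,
      entriesOp a v j = ∑ l, v (.inr (.inl (.inl (j, l)))) := by
    intro v j
    simp only [entriesOp_apply, a, Fintype.sum_sum_type, Sum.elim_inl, Sum.elim_inr,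
      zero_apply, Finset.sum_const_zero, zero_add, add_zero]
    rw [Fintype.sum_prod_type, Finset.sum_eq_single j]
    · simp
    · intro j' _ hj'
      simp [hj']
    · simp
  have hA : Equivariant (entriesOp fun i j => groupRingOp (A i j)) :=
    equivariant_entriesOp fun i j => groupRingOp_mem_groupVN (A i j)
  have hinj : ∀ v ∈ X, ((entriesOp fun i j => groupRingOp (A i j)) ∘L entriesOp a) v = 0 →
      v = 0 := by
    intro v hv h0
    have hv := mem_iInf_coordGraph.1 hv
    have hQ : ∀ j l, (Q j l).Rel (v (.inl l)) (v (.inr (.inl (.inl (j, l))))) :=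
      fun j l => hv (.inl (.inl (j, l)))
    have hB : ∀ i l, (B i l).Rel (v (.inl l)) (v (.inr (.inl (.inr (i, l))))) :=
      fun i l => hv (.inl (.inr (i, l)))
    have hP : ∀ k i l, (P k i).Rel (v (.inr (.inl (.inr (i, l))))) (v (.inr (.inr (k, i, l)))) :=
      fun k i l => hv (.inr (k, i, l))
    have h1 : ∀ i l, v (.inr (.inl (.inr (i, l)))) =
        ∑ j, groupRingOp (A i j) (v (.inr (.inl (.inl (j, l))))) := by
      intro i l
      have h := Affil.rel_sum (s := Finset.univ) fun j _ =>
        (hQ j l).mul_apply ((Affil.rel_ofGroupRing (a := A i j)).2 rfl)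
      rw [hAQ] at h
      exact (hB i l).unique h
    have h2 : ∀ i, ∑ l, v (.inr (.inl (.inr (i, l)))) = 0 := by
      intro i
      have h := congrArg (fun u : L2Fam Γ I => u i) h0
      simp only [ContinuousLinearMap.comp_apply, entriesOp_apply (fun i j => groupRingOp (A i j)),
        hav, map_sum] at h
      simp only [h1]
      rw [Finset.sum_comm]
      exact h
    have h3 : ∀ k i, ∑ l, v (.inr (.inr (k, i, l))) = 0 := by
      intro k i
      have h := Affil.Rel.sum (s := Finset.univ) fun l _ => hP k i l
      rw [h2] at h
      exact h.eq_zero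
    have h4 : ∀ k l, ∑ i, v (.inr (.inr (k, i, l))) = if k = l then v (.inl l) else 0 := by
      intro k l
      have h := Affil.rel_sum (s := Finset.univ) fun i _ => (hB i l).mul_apply (hP k i l)
      have h5 : ∑ i, P k i * B i l = (1 : Matrix L L (Affil Γ)) k l := by
        rw [← hPB, Matrix.mul_apply]
      rw [h5, Matrix.one_apply] at h
      split_ifs at h ⊢
      · exact Affil.rel_one.1 h
      · exact Affil.rel_zero.1 h
    have hL : ∀ k, v (.inl k) = 0 := by
      intro k
      -- The double sum of `P_ki B_il w_l` is `w_k` when summed over `i` first, and zero when summed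
      -- over `l` first because `Bw = 0`.
      have h : ∑ l, ∑ i, v (.inr (.inr (k, i, l))) = v (.inl k) := by
        simp [h4]
      rw [← h, Finset.sum_comm]
      exact Finset.sum_eq_zero fun i _ => h3 k i
    have hIL : ∀ i l, v (.inr (.inl (.inr (i, l)))) = 0 := by
      intro i l
      have h := hB i l
      rw [hL] at h
      exact h.eq_zero
    ext1 i
    rcases i with l | ((⟨j, l⟩ | ⟨i, l⟩) | ⟨k, i, l⟩)
    · exact hL l
    · have h := hQ j l
      rw [hL] at h
      exact h.eq_zero
    · exact hIL i l
    · have h := hP k i l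
      rw [hIL] at h
      exact h.eq_zero
  have hmap := hX.famDim_map_of_injOn (hA.comp ha) hinj
  have hmono := (hX.closure_map (hA.comp ha)).famDim_mono (IsClosedInvariant.top.closure_map hA)
    (Submodule.topologicalClosure_mono (by
      rintro _ ⟨v, -, rfl⟩
      exact ⟨entriesOp a v, trivial, rfl⟩))
  rw [famDim_topologicalClosure, famDim_topologicalClosure, hmap,
    ← LinearMap.range_eq_map] at hmono
  have := famDim_ker_add_famDim_range hA
  linarith

/-- The rank `r` of `A` over the skew field gives both bounds: the dimension of the kernel is `d -
r`. -/
theorem algebraicAtiyah_of_isUnit (hΓ : ∀ g : Γ, g ≠ 1 → ¬ IsOfFinOrder g)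
    (h : ∀ T : divClosure Γ K, T ≠ 0 → IsUnit T) : AlgebraicAtiyah Γ K := by
  rw [algebraicAtiyah_iff hΓ]
  intro d A
  let D : DivisionRing (divClosure Γ K) :=
    DivisionRing.ofIsUnitOrEqZero fun T => or_iff_not_imp_right.2 (h T)
  let A' : Matrix (Fin d) (Fin d) (divClosure Γ K) :=
    fun i j => ⟨Affil.ofGroupRing (A i j), .of (A i j)⟩
  obtain ⟨r, B, C, P, Q, hA', hPB, hCQ⟩ := A'.exists_rank_factorization
  let φ := (divClosure Γ K).subtype
  have hAQ : A' * Q = B := by rw [hA', Matrix.mul_assoc, hCQ, Matrix.mul_one]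
  refine ⟨d - r, le_antisymm ?_ ?_⟩
  · have h1 := famDim_ker_le_of_factorization A (B.map φ) (P.map φ) (Q.map φ) (fun i l => ?_) ?_
    · simpa using h1
    · rw [Matrix.map_apply, ← hAQ, Matrix.mul_apply, map_sum]
      rfl
    · have h2 : (P * B).map φ = P.map φ * B.map φ := Matrix.map_mul
      rw [← h2, hPB, Matrix.map_one _ (map_zero φ) (map_one φ)]
  · have h1 := le_famDim_ker_of_factorization A (B.map φ) (C.map φ) fun i j => ?_
    · simpa using h1
    · have h2 := congrArg φ (congrFun (congrFun hA' i) j)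
      rw [Matrix.mul_apply, map_sum] at h2
      exact h2

end Factorization

end L2Group

end

theorem mainTheorem3 {Γ : Type*} [Group Γ]
    (hΓ : ∀ g : Γ, g ≠ 1 → ¬ IsOfFinOrder g)
    (K : Subfield ℂ) (hK : ∀ z ∈ K, starRingEnd ℂ z ∈ K) :
    L2Group.AlgebraicAtiyah Γ K ↔ L2Group.IsSkewField (L2Group.DivisionClosure Γ K) := by
  rw [L2Group.isSkewField_iff]
  exact ⟨L2Group.isUnit_divClosure hΓ, L2Group.algebraicAtiyah_of_isUnit hΓ⟩
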